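/- Let $p>2$ be a prime, and let $v\in\mathbb{Q}_p$ be $-1$ if $p\equiv 3 \bmod 4$, and $-u$ for some non-quadratic unit $u$ (i.e. $|u|_p=1$ and $u$ is not a square in $\mathbb{Q}_p$) if $p\equiv 1\bmod 4$. Let $A_+=\operatorname{diag}(1,-v,p)$ and $$\mathrm{SO}(3)_p=\{L\in \mathsf{M}(3,\mathbb{Q}_p) : L^\top A_+L=A_+,\ \det L=1\},$$ a compact group for the $p$-adic topology, with normalized Haar measure $\mu$ (total mass $1$). For $\alpha,\beta,\gamma\in\mathbb{Q}_p\cup\{\infty\}$ let $$\mathcal{R}_z(\alpha)=\begin{pmatrix}\frac{1+v\alpha^2}{1-v\alpha^2}&\frac{2v\alpha}{1-v\alpha^2}&0\\ \frac{2\alpha}{1-v\alpha^2}&\frac{1+v\alpha^2}{1-v\alpha^2}&0\\0&0&1\end{pmatrix},\quad \mathcal{R}_y(\beta)=\begin{pmatrix}\frac{1-p\beta^2}{1+p\beta^2}&0&-\frac{2p\beta}{1+p\beta^2}\\0&1&0\\ \frac{2\beta}{1+p\beta^2}&0&\frac{1-p\beta^2}{1+p\beta^2}\end{pmatrix},\quad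 \mathcal{R}_x(\gamma)=\begin{pmatrix}1&0&0\\0&\frac{1+\frac pv\gamma^2}{1-\frac pv\gamma^2}&\frac{2\frac pv\gamma}{1-\frac pv\gamma^2}\\0&\frac{2\gamma}{1-\frac pv\gamma^2}&\frac{1+\frac pv\gamma^2}{1-\frac pv\gamma^2}\end{pmatrix},$$ with $\mathcal{R}_z(\infty)=\operatorname{diag}(-1,-1,1)$, $\mathcal{R}_y(\infty)=\operatorname{diag}(-1,1,-1)$, $\mathcal{R}_x(\infty)=\operatorname{diag}(1,-1,-1)$. Let $\mathbb{H}_p$ be the quaternion algebra over $\mathbb{Q}_p$ with $\mathbf{i}^2=v$, $\mathbf{j}^2=-p$, $\mathbf{k}=\mathbf{i}\mathbf{j}=-\mathbf{j}\mathbf{i}$. For $\xi\in\mathbb{H}_p^\times$ let $K_p(\xi)$ be the matrix of $\eta\mapsto\xi\eta\xi^{-1}$ on pure quaternions in the basis $(\mathbf{i},\mathbf{j},\mathbf{k})$, and let $\mathcal{T}_p\colon\mathbb{H}_p^\times/\mathbb{Q}_p^\times\to\mathrm{SO}(3)_p$, $\xi\mathbb{Q}_p^\times\mapsto\Lambda K_p(\xi)\Lambda^{-1}$,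 where $\Lambda=\begin{pmatrix}0&0&-vp\\0&p&0\\-v&0&0\end{pmatrix}$. Write $(\phi\circ\mathcal{T}_p)(\alpha)$, $(\phi\circ\mathcal{T}_p)(\beta)$, $(\phi\circ\mathcal{T}_p)(\gamma)$ for the value of $\phi\circ\mathcal{T}_p$ at the class of $1-\alpha\mathbf{i}$, of $1+\beta\mathbf{j}$, of $1+\frac{\gamma}{v}\mathbf{k}$, respectively (of $\mathbf{i}$, $\mathbf{j}$, $\mathbf{k}$ if the parameter is $\infty$); these are the quaternions of the rotations $\mathcal{R}_z(\alpha)$, $\mathcal{R}_y(\beta)$, $\mathcal{R}_x(\gamma)$. Let $d\alpha,d\beta,d\gamma$ denote the Haar measure of $\mathbb{Q}_p$ with mass $1$ on $\mathbb{Z}_p$, extended to $\mathbb{Q}_p\cup\{\infty\}$ by giving the point $\infty$ mass $0$. Let $\phi\colon\mathrm{SO}(3)_p\to\mathbb{C}$ be $\mu$-integrable. 1. If $\phi(\mathcal{R}_z(\alpha)\mathcal{R}_y(\beta)\mathcal{R}_x(\gamma))=\phi(\mathcal{R}_z(\alpha))$ for all $\alpha,\beta,\gamma\in\mathbb{Q}_p\cup\{\infty\}$,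 then $$\int_{\mathrm{SO}(3)_p}\phi\,d\mu=\Big(1+\frac1p\Big)^{-1}\int_{\mathbb{Q}_p\cup\{\infty\}}(\phi\circ\mathcal{T}_p)(\alpha)\,\frac{d\alpha}{|1-v\alpha^2|_p}.$$ 2. If $\phi(\mathcal{R}_z(\alpha)\mathcal{R}_y(\beta)\mathcal{R}_x(\gamma))=\phi(\mathcal{R}_y(\beta))$ for all $\alpha,\beta,\gamma\in\mathbb{Q}_p\cup\{\infty\}$, then $$\int_{\mathrm{SO}(3)_p}\phi\,d\mu=\frac12\int_{\mathbb{Q}_p\cup\{\infty\}}(\phi\circ\mathcal{T}_p)(\beta)\,\frac{d\beta}{|1+p\beta^2|_p}.$$ 3. If $\phi(\mathcal{R}_z(\alpha)\mathcal{R}_y(\beta)\mathcal{R}_x(\gamma))=\phi(\mathcal{R}_x(\gamma))$ for all $\alpha,\beta,\gamma\in\mathbb{Q}_p\cup\{\infty\}$, then $$\int_{\mathrm{SO}(3)_p}\phi\,d\mu=\frac12\int_{\mathbb{Q}_p\cup\{\infty\}}(\phi\circ\mathcal{T}_p)(\gamma)\,\frac{d\gamma}{|1-\frac pv\gamma^2|_p}.$$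 In each case the integrand on the right-hand side is integrable. -/

import Mathlib

open MeasureTheory
open scoped Quaternion

noncomputable section

namespace PadicRot

variable {p : ℕ} [Fact p.Prime]

/-! ### The parameter `v` -/

/-- A non-quadratic `p`-adic unit: `|u|_p = 1` and `u` is not a square. -/
def IsNonquadraticUnit (u : ℚ_[p]) : Prop := ‖u‖ = 1 ∧ ¬ IsSquare u

/-- The possible values of the unit `v`: it is `-1` if `p ≡ 3 mod 4`, and `-u` for a non-quadratic
unit `u` if `p ≡ 1 mod 4`. -/
def IsVParam (v : ℚ_[p]) : Prop :=
  (p % 4 = 3 ∧ v = -1) ∨ (p % 4 = 1 ∧ ∃ u : ℚ_[p], IsNonquadraticUnit u ∧ v = -u)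

theorem isSquare_neg_one (h : p % 4 = 1) : IsSquare (-1 : ℚ_[p]) := by
  have hp : p.Prime := Fact.out
  have h3 : p % 4 ≠ 3 := by omega
  obtain ⟨a, ha⟩ := (ZMod.exists_sq_eq_neg_one_iff (p := p)).2 h3
  obtain ⟨n, rfl⟩ : ∃ n : ℤ, (n : ZMod p) = a := ZMod.intCast_surjective a
  have h1 : (p : ℤ) ∣ n * n + 1 := by
    rw [← ZMod.intCast_zmod_eq_zero_iff_dvd]
    push_cast
    rw [← ha]
    ring
  have h2 : ¬ (p : ℤ) ∣ 2 * n := by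
    intro hd
    have hpp : Prime (p : ℤ) := Nat.prime_iff_prime_int.mp hp
    rcases hpp.dvd_or_dvd hd with hd | hd
    · have := Nat.le_of_dvd (by norm_num) (Int.natCast_dvd_natCast.mp (by exact_mod_cast hd) :
        p ∣ 2)
      have := hp.two_le
      omega
    · have h4 : (p : ℤ) ∣ 1 := by
        have := dvd_sub h1 (Dvd.dvd.mul_left hd n)
        simpa using this
      exact hpp.not_isUnit (isUnit_of_dvd_one h4)
  have hder : ‖((2 * n : ℤ) : ℤ_[p])‖ = 1 := by
    refine le_antisymm (PadicInt.norm_le_one _) ?_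
    by_contra hlt
    exact h2 ((PadicInt.norm_int_lt_one_iff_dvd _).1 (not_le.1 hlt))
  have hval : ‖((n * n + 1 : ℤ) : ℤ_[p])‖ < 1 := (PadicInt.norm_int_lt_one_iff_dvd _).2 h1
  obtain ⟨z, hz, -⟩ := hensels_lemma (p := p) (R := ℤ_[p]) (a := (n : ℤ_[p]))
    (F := (Polynomial.X ^ 2 + 1 : Polynomial ℤ_[p])) (by
      have e1 : (Polynomial.aeval (n : ℤ_[p])) (Polynomial.X ^ 2 + 1 : Polynomial ℤ_[p])
          = ((n * n + 1 : ℤ) : ℤ_[p]) := by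
        simp [sq]
      have e2 : (Polynomial.aeval (n : ℤ_[p]))
          (Polynomial.derivative (Polynomial.X ^ 2 + 1 : Polynomial ℤ_[p]))
          = ((2 * n : ℤ) : ℤ_[p]) := by
        simp only [sq, Polynomial.derivative_mul,
          Polynomial.derivative_X, Polynomial.derivative_one, map_add, map_mul,
          Polynomial.aeval_X, map_one, map_zero]
        push_cast
        ring
      rw [e1, e2, hder]
      simpa using hval)
  have hz' : z ^ 2 + 1 = 0 := by simpa using hz
  refine ⟨(z : ℚ_[p]), ?_⟩
  have : ((z ^ 2 + 1 : ℤ_[p]) : ℚ_[p]) = 0 := by rw [hz']; simp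
  push_cast at this
  linear_combination -this

theorem not_isSquare_neg_one (h : p % 4 = 3) : ¬ IsSquare (-1 : ℚ_[p]) := by
  rintro ⟨x, hx⟩
  have hn : ‖x‖ = 1 := by
    have : ‖x‖ * ‖x‖ = 1 := by rw [← norm_mul, ← hx]; simp
    nlinarith [norm_nonneg x]
  let y : ℤ_[p] := ⟨x, hn.le⟩
  have hy : y * y = -1 := by
    apply Subtype.ext
    exact hx.symm
  have : (PadicInt.toZMod y) ^ 2 = -1 := by
    rw [sq, ← map_mul, hy]; simp
  exact ZMod.mod_four_ne_three_of_sq_eq_neg_one this h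

theorem IsVParam.nonquadratic {v : ℚ_[p]} (hv : IsVParam v) : IsNonquadraticUnit v := by
  rcases hv with ⟨h, rfl⟩ | ⟨h, u, hu, rfl⟩
  · exact ⟨by simp, not_isSquare_neg_one h⟩
  · refine ⟨by simpa using hu.1, fun hs => hu.2 ?_⟩
    have := (isSquare_neg_one (p := p) h).mul hs
    simpa using this

section Denominators

variable {v : ℚ_[p]}

theorem IsVParam.ne_zero (hv : IsVParam v) : v ≠ 0 := by
  intro h
  have := hv.nonquadratic.1
  simp [h] at this

theorem p_ne_zero : (p : ℚ_[p]) ≠ 0 := by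
  exact_mod_cast (Fact.out : p.Prime).ne_zero

theorem denomZ_ne_zero (hv : IsVParam v) (α : ℚ_[p]) : 1 - v * α ^ 2 ≠ 0 := by
  intro h
  have hα : α ≠ 0 := by
    rintro rfl
    simp at h
  refine hv.nonquadratic.2 ⟨α⁻¹, ?_⟩
  field_simp
  linear_combination -h

theorem p_mul_ne_sq {w : ℚ_[p]} (hw : ‖w‖ = 1) (β : ℚ_[p]) : 1 + p * w * β ^ 2 ≠ 0 := by
  intro h
  have hβ : β ≠ 0 := by
    rintro rfl
    simp at h
  have h1 : (p : ℚ_[p]) * w * β ^ 2 = -1 := by linear_combination h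
  have h2 := congrArg norm h1
  have hn := Padic.norm_eq_zpow_neg_valuation hβ
  have hp1 : (1 : ℝ) < p := by exact_mod_cast (Fact.out : p.Prime).one_lt
  have hp0 : (p : ℝ) ≠ 0 := by positivity
  rw [norm_mul, norm_mul, hw, norm_pow, Padic.norm_p, hn, norm_neg, norm_one, mul_one,
    ← zpow_neg_one, ← zpow_natCast, ← zpow_mul, ← zpow_add₀ hp0, ← zpow_zero (p : ℝ)] at h2
  have h3 := zpow_right_injective₀ (by linarith) hp1.ne' h2
  push_cast at h3
  omega

theorem denomY_ne_zero (β : ℚ_[p]) : 1 + p * β ^ 2 ≠ 0 := by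
  simpa using p_mul_ne_sq (w := (1 : ℚ_[p])) (by simp) β

theorem denomX_ne_zero (hv : IsVParam v) (γ : ℚ_[p]) : 1 - p / v * γ ^ 2 ≠ 0 := by
  have := p_mul_ne_sq (w := -v⁻¹) (by simp [hv.nonquadratic.1]) γ
  intro h
  apply this
  rw [← h]
  ring

theorem denomX_ne_zero' (hv : IsVParam v) (γ : ℚ_[p]) : v - p * γ ^ 2 ≠ 0 := by
  have h0 := hv.ne_zero
  have := denomX_ne_zero hv γ
  intro h
  apply this
  field_simp
  simpa using h

end Denominators

/-! ### The group `SO(3)_p` -/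

/-- The matrix `A₊ = diag(1, -v, p)` of the definite ternary quadratic form. -/
def formMatrix (v : ℚ_[p]) : Matrix (Fin 3) (Fin 3) ℚ_[p] := Matrix.diagonal ![1, -v, p]

/-- `SO(3)_p`: the `3 × 3` matrices `L` of determinant `1` with `Lᵀ A₊ L = A₊`, with the group
structure and the topology of matrices. -/
def SO3 (v : ℚ_[p]) : Subgroup (Matrix.SpecialLinearGroup (Fin 3) ℚ_[p]) where
  carrier := {L | (L : Matrix (Fin 3) (Fin 3) ℚ_[p]).transpose * formMatrix v *
    (L : Matrix (Fin 3) (Fin 3) ℚ_[p]) = formMatrix v}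
  one_mem' := by simp
  mul_mem' {L M} hL hM := by
    simp only [Set.mem_ofPred_eq, Matrix.SpecialLinearGroup.coe_mul, Matrix.transpose_mul] at *
    rw [show ∀ a b c d e : Matrix (Fin 3) (Fin 3) ℚ_[p],
      a * b * c * (d * e) = a * (b * c * d) * e by intros; simp only [Matrix.mul_assoc]]
    rw [hL, hM]
  inv_mem' {L} hL := by
    simp only [Set.mem_ofPred_eq] at *
    have h1 : (L : Matrix (Fin 3) (Fin 3) ℚ_[p]) *
        ((L⁻¹ : Matrix.SpecialLinearGroup (Fin 3) ℚ_[p]) : Matrix (Fin 3) (Fin 3) ℚ_[p]) = 1 := by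
      rw [← Matrix.SpecialLinearGroup.coe_mul]
      simp
    have h2 := congrArg Matrix.transpose h1
    rw [Matrix.transpose_mul, Matrix.transpose_one] at h2
    nth_rewrite 1 [← hL]
    rw [show ∀ a b c d e : Matrix (Fin 3) (Fin 3) ℚ_[p],
      a * (b * c * d) * e = (a * b) * c * (d * e) by intros; simp only [Matrix.mul_assoc]]
    rw [h1, h2]
    simp

instance (v : ℚ_[p]) : MeasurableSpace (SO3 v) := borel _

instance (v : ℚ_[p]) : BorelSpace (SO3 v) := ⟨rfl⟩

/-- The element of `SO(3)_p` with a given matrix. -/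
def SO3.ofMatrix {v : ℚ_[p]} (L : Matrix (Fin 3) (Fin 3) ℚ_[p]) (hdet : L.det = 1)
    (hL : L.transpose * formMatrix v * L = formMatrix v) : SO3 v := ⟨⟨L, hdet⟩, hL⟩

/-! ### Rotations around the reference axes, with parameters in `ℚ_p ∪ {∞}` -/

/-- The matrix of the rotation `R_z(α)`. -/
def matZ (v : ℚ_[p]) (α : OnePoint ℚ_[p]) : Matrix (Fin 3) (Fin 3) ℚ_[p] :=
  α.elim !![-1, 0, 0; 0, -1, 0; 0, 0, 1] fun a =>
    !![(1 + v * a ^ 2) / (1 - v * a ^ 2), 2 * v * a / (1 - v * a ^ 2), 0;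
       2 * a / (1 - v * a ^ 2), (1 + v * a ^ 2) / (1 - v * a ^ 2), 0;
       0, 0, 1]

/-- The matrix of the rotation `R_y(β)`. -/
def matY (β : OnePoint ℚ_[p]) : Matrix (Fin 3) (Fin 3) ℚ_[p] :=
  β.elim !![-1, 0, 0; 0, 1, 0; 0, 0, -1] fun b =>
    !![(1 - p * b ^ 2) / (1 + p * b ^ 2), 0, -(2 * p * b) / (1 + p * b ^ 2);
       0, 1, 0;
       2 * b / (1 + p * b ^ 2), 0, (1 - p * b ^ 2) / (1 + p * b ^ 2)]

/-- The matrix of the rotation `R_x(γ)`. -/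
def matX (v : ℚ_[p]) (γ : OnePoint ℚ_[p]) : Matrix (Fin 3) (Fin 3) ℚ_[p] :=
  γ.elim !![1, 0, 0; 0, -1, 0; 0, 0, -1] fun c =>
    !![1, 0, 0;
       0, (1 + p / v * c ^ 2) / (1 - p / v * c ^ 2), 2 * (p / v) * c / (1 - p / v * c ^ 2);
       0, 2 * c / (1 - p / v * c ^ 2), (1 + p / v * c ^ 2) / (1 - p / v * c ^ 2)]

/-- The rotation `R_z(α)` around the axis `z`. -/
def rotZ {v : ℚ_[p]} (hv : IsVParam v) (α : OnePoint ℚ_[p]) : SO3 v :=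
  SO3.ofMatrix (matZ v α)
    (by
      induction α using OnePoint.rec with
      | infty => simp [matZ, Matrix.det_fin_three]
      | coe a =>
        have h := denomZ_ne_zero hv a
        simp [matZ, Matrix.det_fin_three]
        field_simp
        ring)
    (by
      induction α using OnePoint.rec with
      | infty =>
        ext i j
        fin_cases i <;> fin_cases j <;>
          simp [matZ, formMatrix, Matrix.mul_apply, Fin.sum_univ_three, Matrix.diagonal]
      | coe a =>
        have h := denomZ_ne_zero hv a
        ext i j
        fin_cases i <;> fin_cases j <;>
          simp [matZ, formMatrix, Matrix.mul_apply, Fin.sum_univ_three, Matrix.diagonal] <;>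
          field_simp <;> ring)

/-- The rotation `R_y(β)` around the axis `y`. -/
def rotY (v : ℚ_[p]) (β : OnePoint ℚ_[p]) : SO3 v :=
  SO3.ofMatrix (matY β)
    (by
      induction β using OnePoint.rec with
      | infty => simp [matY, Matrix.det_fin_three]
      | coe a =>
        have h := denomY_ne_zero a
        simp [matY, Matrix.det_fin_three]
        field_simp
        ring)
    (by
      induction β using OnePoint.rec with
      | infty =>
        ext i j
        fin_cases i <;> fin_cases j <;>
          simp [matY, formMatrix, Matrix.mul_apply, Fin.sum_univ_three, Matrix.diagonal]
      | coe a =>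
        have h := denomY_ne_zero a
        ext i j
        fin_cases i <;> fin_cases j <;>
          simp [matY, formMatrix, Matrix.mul_apply, Fin.sum_univ_three, Matrix.diagonal] <;>
          field_simp <;> ring)

/-- The rotation `R_x(γ)` around the axis `x`. -/
def rotX {v : ℚ_[p]} (hv : IsVParam v) (γ : OnePoint ℚ_[p]) : SO3 v :=
  SO3.ofMatrix (matX v γ)
    (by
      induction γ using OnePoint.rec with
      | infty => simp [matX, Matrix.det_fin_three]
      | coe a =>
        have h0 := hv.ne_zero
        have h := denomX_ne_zero' hv a
        simp [matX, Matrix.det_fin_three]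
        field_simp
        ring)
    (by
      induction γ using OnePoint.rec with
      | infty =>
        ext i j
        fin_cases i <;> fin_cases j <;>
          simp [matX, formMatrix, Matrix.mul_apply, Fin.sum_univ_three, Matrix.diagonal]
      | coe a =>
        have h0 := hv.ne_zero
        have h := denomX_ne_zero' hv a
        ext i j
        fin_cases i <;> fin_cases j <;>
          simp [matX, formMatrix, Matrix.mul_apply, Fin.sum_univ_three, Matrix.diagonal] <;>
          field_simp <;> ring)

/-! ### Quaternions and the isomorphism `T_p` -/

/-- The `p`-adic quaternion algebra: `i² = v`, `j² = -p`, `k = ij = -ji`. -/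
abbrev Hp (v : ℚ_[p]) : Type := ℍ[ℚ_[p], v, 0, -(p : ℚ_[p])]

/-- The reduced norm. -/
def nrd {v : ℚ_[p]} (ξ : Hp v) : ℚ_[p] :=
  ξ.re ^ 2 - v * ξ.imI ^ 2 + p * ξ.imJ ^ 2 - v * p * ξ.imK ^ 2

theorem nrd_mul {v : ℚ_[p]} (ξ η : Hp v) : nrd (ξ * η) = nrd ξ * nrd η := by
  simp [nrd]
  ring

theorem nrd_unit_ne_zero {v : ℚ_[p]} (ξ : (Hp v)ˣ) : nrd (ξ : Hp v) ≠ 0 := by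
  intro h
  have h1 := nrd_mul (ξ : Hp v) ((ξ⁻¹ : (Hp v)ˣ) : Hp v)
  rw [h, Units.mul_inv] at h1
  simp [nrd] at h1

/-- A quaternion of non-zero reduced norm, as a unit. -/
def unitOfNrd {v : ℚ_[p]} (ξ : Hp v) (h : nrd ξ ≠ 0) : (Hp v)ˣ where
  val := ξ
  inv := (nrd ξ)⁻¹ • star ξ
  val_inv := by
    ext <;> simp <;> field_simp <;> simp [nrd] <;> ring
  inv_val := by
    ext <;> simp <;> field_simp <;> simp [nrd] <;> ring

/-- The inverse of a unit, through the conjugate and the reduced norm. -/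
theorem coe_inv_eq {v : ℚ_[p]} (ξ : (Hp v)ˣ) :
    ((ξ⁻¹ : (Hp v)ˣ) : Hp v) = (nrd (ξ : Hp v))⁻¹ • star (ξ : Hp v) := by
  have h : ξ = unitOfNrd (ξ : Hp v) (nrd_unit_ne_zero ξ) := Units.ext rfl
  conv_lhs => rw [h]
  rfl

/-- The basis `(i, j, k)` of the space of pure quaternions. -/
def pureBasis (v : ℚ_[p]) : Fin 3 → Hp v := ![⟨0, 1, 0, 0⟩, ⟨0, 0, 1, 0⟩, ⟨0, 0, 0, 1⟩]

/-- The coordinates of the pure part of a quaternion with respect to `(i, j, k)`. -/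
def pureCoord {v : ℚ_[p]} (ξ : Hp v) : Fin 3 → ℚ_[p] := ![ξ.imI, ξ.imJ, ξ.imK]

/-- `K_p(ξ)`: the matrix, with respect to `(i, j, k)`, of the conjugation `η ↦ ξ η ξ⁻¹` on pure
quaternions. -/
def conjMatrix {v : ℚ_[p]} (ξ : (Hp v)ˣ) : Matrix (Fin 3) (Fin 3) ℚ_[p] :=
  Matrix.of fun i j => pureCoord ((ξ : Hp v) * pureBasis v j * ((ξ⁻¹ : (Hp v)ˣ) : Hp v)) i

/-- The change of basis `Λ` between pure quaternions and `ℚ_p³` with the form `A₊`. -/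
def lambdaMatrix (v : ℚ_[p]) : Matrix (Fin 3) (Fin 3) ℚ_[p] :=
  !![0, 0, -v * p; 0, p, 0; -v, 0, 0]

theorem lambdaMatrix_inv {v : ℚ_[p]} (hv : v ≠ 0) :
    (lambdaMatrix v)⁻¹ = !![0, 0, -v⁻¹; 0, (p : ℚ_[p])⁻¹, 0; -(v * p)⁻¹, 0, 0] := by
  have hp := p_ne_zero (p := p)
  apply Matrix.inv_eq_right_inv
  ext i j
  fin_cases i <;> fin_cases j <;>
    simp [lambdaMatrix, Matrix.mul_apply, Fin.sum_univ_three, hv, hp] <;> field_simp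

/-- The entries of `K_p(ξ)`. -/
theorem conjMatrix_eq {v : ℚ_[p]} (ξ : (Hp v)ˣ) :
    conjMatrix ξ = (nrd (ξ : Hp v))⁻¹ •
      (let q0 := (ξ : Hp v).re
       let q1 := (ξ : Hp v).imI
       let q2 := (ξ : Hp v).imJ
       let q3 := (ξ : Hp v).imK
       !![q0 ^ 2 - v * q1 ^ 2 - p * q2 ^ 2 + v * p * q3 ^ 2, 2 * p * (q1 * q2 - q0 * q3),
            2 * p * (q0 * q2 - v * q1 * q3);
          -2 * v * (q0 * q3 + q1 * q2), q0 ^ 2 + v * q1 ^ 2 + p * q2 ^ 2 + v * p * q3 ^ 2,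
            2 * v * (q0 * q1 - p * q2 * q3);
          -2 * (q0 * q2 + v * q1 * q3), 2 * (q0 * q1 + p * q2 * q3),
            q0 ^ 2 + v * q1 ^ 2 - p * q2 ^ 2 - v * p * q3 ^ 2]) := by
  ext i j
  fin_cases i <;> fin_cases j <;>
    simp [conjMatrix, coe_inv_eq, pureCoord, pureBasis, -mul_eq_mul_left_iff] <;> ring

/-- The entries of `Λ K_p(ξ) Λ⁻¹`. -/
theorem conj_explicit {v : ℚ_[p]} (hv : v ≠ 0) (ξ : (Hp v)ˣ) :
    lambdaMatrix v * conjMatrix ξ * (lambdaMatrix v)⁻¹ =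
      (nrd (ξ : Hp v))⁻¹ •
        (let q0 := (ξ : Hp v).re
         let q1 := (ξ : Hp v).imI
         let q2 := (ξ : Hp v).imJ
         let q3 := (ξ : Hp v).imK
         !![q0 ^ 2 + v * q1 ^ 2 - p * q2 ^ 2 - v * p * q3 ^ 2, -2 * v * (q0 * q1 + p * q2 * q3),
              -2 * p * (q0 * q2 + v * q1 * q3);
            2 * (p * q2 * q3 - q0 * q1), q0 ^ 2 + v * q1 ^ 2 + p * q2 ^ 2 + v * p * q3 ^ 2,
              2 * p * (q1 * q2 + q0 * q3);
            2 * (q0 * q2 - v * q1 * q3), 2 * v * (q0 * q3 - q1 * q2),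
              q0 ^ 2 - v * q1 ^ 2 - p * q2 ^ 2 + v * p * q3 ^ 2]) := by
  have hp := p_ne_zero (p := p)
  rw [lambdaMatrix_inv hv, conjMatrix_eq, Matrix.mul_smul, Matrix.smul_mul]
  congr 1
  ext i j
  fin_cases i <;> fin_cases j <;>
    simp [lambdaMatrix, Matrix.mul_apply, Fin.sum_univ_three,
      -mul_eq_mul_left_iff, -mul_eq_mul_right_iff] <;>
    field_simp <;> ring

/-- The map `ξ ↦ Λ K_p(ξ) Λ⁻¹` from invertible quaternions to `SO(3)_p`. -/
def quatRot {v : ℚ_[p]} (hv : IsVParam v) (ξ : (Hp v)ˣ) : SO3 v :=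
  SO3.ofMatrix (lambdaMatrix v * conjMatrix ξ * (lambdaMatrix v)⁻¹)
    (by
      have hn := nrd_unit_ne_zero ξ
      rw [conj_explicit hv.ne_zero]
      simp [Matrix.det_fin_three]
      field_simp
      simp only [nrd]
      ring)
    (by
      have hn := nrd_unit_ne_zero ξ
      rw [conj_explicit hv.ne_zero]
      ext i j
      fin_cases i <;> fin_cases j <;>
        simp [formMatrix, Matrix.mul_apply, Fin.sum_univ_three, Matrix.diagonal] <;>
        field_simp <;> simp only [nrd] <;> ring)

/-- The subgroup `ℚ_p^×` of scalars in the group of invertible quaternions. -/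
def scalarUnits (v : ℚ_[p]) : Subgroup (Hp v)ˣ :=
  (Units.map (algebraMap ℚ_[p] (Hp v)).toMonoidHom).range

/-- The map `T_p` from invertible quaternions modulo scalars to `SO(3)_p`, sending the class of `ξ`
to `Λ K_p(ξ) Λ⁻¹`. -/
def Tp {v : ℚ_[p]} (hv : IsVParam v) : (Hp v)ˣ ⧸ scalarUnits v → SO3 v :=
  Quotient.lift (quatRot hv) (by
    intro ξ η h
    obtain ⟨c, hc⟩ := QuotientGroup.leftRel_apply.mp h
    have hη : η = ξ * Units.map (algebraMap ℚ_[p] (Hp v)).toMonoidHom c := by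
      rw [hc]; group
    have key : conjMatrix ξ = conjMatrix η := by
      have hcc : ((algebraMap ℚ_[p] (Hp v)) (c : ℚ_[p])) *
          ((algebraMap ℚ_[p] (Hp v)) ((c⁻¹ : ℚ_[p]ˣ) : ℚ_[p])) = 1 := by
        rw [← map_mul]; simp
      have hz : ∀ b : Hp v, (η : Hp v) * b * ((η⁻¹ : (Hp v)ˣ) : Hp v) =
          (ξ : Hp v) * b * ((ξ⁻¹ : (Hp v)ˣ) : Hp v) := by
        intro b
        rw [hη, mul_inv_rev, Units.val_mul, Units.val_mul, ← map_inv]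
        simp only [Units.coe_map, RingHom.toMonoidHom_eq_coe, MonoidHom.coe_coe]
        rw [mul_assoc (ξ : Hp v) _ b, Algebra.commutes (c : ℚ_[p]) b, ← mul_assoc (ξ : Hp v) b,
          mul_assoc ((ξ : Hp v) * b), ← mul_assoc (algebraMap _ _ _) _
            ((ξ⁻¹ : (Hp v)ˣ) : Hp v), hcc, one_mul]
      unfold conjMatrix
      ext i j
      simp only [Matrix.of_apply, hz]
    unfold quatRot
    simp only [key])

/-- The quaternion of the rotation `R_z(α)`: `1 - α i`, and `i` for `α = ∞`. -/
def quatZ {v : ℚ_[p]} (hv : IsVParam v) (α : OnePoint ℚ_[p]) : (Hp v)ˣ :=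
  unitOfNrd (α.elim ⟨0, 1, 0, 0⟩ fun a => ⟨1, -a, 0, 0⟩) (by
    induction α using OnePoint.rec with
    | infty => simp [nrd, hv.ne_zero]
    | coe a => simpa [nrd] using denomZ_ne_zero hv a)

/-- The quaternion of the rotation `R_y(β)`: `1 + β j`, and `j` for `β = ∞`. -/
def quatY (v : ℚ_[p]) (β : OnePoint ℚ_[p]) : (Hp v)ˣ :=
  unitOfNrd (β.elim ⟨0, 0, 1, 0⟩ fun b => ⟨1, 0, b, 0⟩) (by
    induction β using OnePoint.rec with
    | infty => simp [nrd, (Fact.out : p.Prime).ne_zero]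
    | coe b => simpa [nrd] using denomY_ne_zero b)

/-- The quaternion of the rotation `R_x(γ)`: `1 + (γ/v) k`, and `k` for `γ = ∞`. -/
def quatX {v : ℚ_[p]} (hv : IsVParam v) (γ : OnePoint ℚ_[p]) : (Hp v)ˣ :=
  unitOfNrd (γ.elim ⟨0, 0, 0, 1⟩ fun c => ⟨1, 0, 0, c / v⟩) (by
    induction γ using OnePoint.rec with
    | infty => simp [nrd, hv.ne_zero, (Fact.out : p.Prime).ne_zero]
    | coe c =>
      have h0 := hv.ne_zero
      have h := denomX_ne_zero hv c
      have e : nrd (⟨1, 0, 0, c / v⟩ : Hp v) = 1 - p / v * c ^ 2 := by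
        simp [nrd]
        field_simp
      simpa [e] using h)

/-! ### Measures -/

instance : MeasurableSpace ℚ_[p] := borel _

instance : BorelSpace ℚ_[p] := ⟨rfl⟩

instance : MeasurableSpace (OnePoint ℚ_[p]) := borel _

instance : BorelSpace (OnePoint ℚ_[p]) := ⟨rfl⟩

/-- The compact set `ℤ_p` in `ℚ_p`. -/
def unitBall (p : ℕ) [Fact p.Prime] : TopologicalSpace.PositiveCompacts ℚ_[p] where
  carrier := Metric.closedBall 0 1
  isCompact' := isCompact_closedBall 0 1
  interior_nonempty' :=
    ⟨0, Metric.ball_subset_interior_closedBall (Metric.mem_ball_self one_pos)⟩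

/-- The Haar measure of the additive group `ℚ_p` with total mass `1` on `ℤ_p`. -/
def padicHaar (p : ℕ) [Fact p.Prime] : Measure ℚ_[p] := Measure.addHaarMeasure (unitBall p)

/-- The same measure on `ℚ_p ∪ {∞}`, where the point `∞` has measure zero. -/
def lineHaar (p : ℕ) [Fact p.Prime] : Measure (OnePoint ℚ_[p]) :=
  (padicHaar p).map (fun σ : ℚ_[p] => (σ : OnePoint ℚ_[p]))

/-- The weight `1 / |1 + d σ²|_p` on `ℚ_p ∪ {∞}`. The value at the null point `∞` is immaterial. -/
def weight (d : ℚ_[p]) (σ : OnePoint ℚ_[p]) : ℝ := σ.elim 0 fun s => 1 / ‖1 + d * s ^ 2‖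

end PadicRot

end

noncomputable section

namespace PadicRot

open Metric Filter Topology
open scoped ENNReal NNReal Matrix

variable {p : ℕ} [Fact p.Prime]

/-! Every rotation factors as `R_z(α) R_y(b) R_x(γ)` with `b` in `ℤ_p` (`exists_decomposition`), and
each formula comes from averaging `φ` over translates by rotations about one axis. Such an average
leaves the Haar integral unchanged, and it turns out not to depend on the translated point.

About `z` and `x` the parameters compose by `σ ⊕ a = (σ + a) / (1 - d a σ)`, with `d = -v` and `d =
-p/v`. The measure `dσ / |1 + d σ²|` is invariant under this law, because the denominator of `σ ⊕ a`
cancels the Jacobian (`measurePreserving_axisMeasure`). It is finite: on `ℤ_p` it is Haar measure,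
and `x ↦ 1/(d x)` carries the rest to Haar measure on `|y| < 1/|d|`. The total is `1 + 1/p` if `|d|
= 1` and `2` if `|d| = 1/p`. In case 1, `φ(R_z(s) R) = φ(R_z(s) R_z(α))` with `α` the first
parameter of `R`, so the average over `s` does not depend on `R`. Case 3 is the mirror image and
uses right invariance of `μ`.

In case 2 the factor `R_y` sits in the middle, so no group law applies directly. But `φ(R)` depends
only on `b`, and `sinY b` is the bottom left entry of `R`. If the top left entry of `Q` is a unit,
the bottom left entry of `R_y(b) Q` is `sinY b * Q 0 0 + cosY b * Q 2 0`. On `ℤ_p` the map `sinY` is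
an isometry and `cosY` a strict contraction, so the parameter of `R_y(b) Q` is an isometric function
of `b`, hence Haar preserving (`exists_isometry_rotY_mul`). If the entry is not a unit, `R_z(1)`
makes it one. This gives `∫ φ = ∫_{ℤ_p} φ(R_y(b)) db`. The involution `b ↦ 1/(p b)` preserves
`φ(R_y(b))` and exchanges `ℤ_p` with its complement up to null sets, whence the factor `1/2`. -/

theorem one_lt_cast_prime : (1 : ℝ) < p := by
  exact_mod_cast (Fact.out : p.Prime).one_lt

theorem cast_prime_pos : (0 : ℝ) < p := zero_lt_one.trans one_lt_cast_prime

/-! ### Haar measure on `ℚ_p` as one-dimensional Hausdorff measure -/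

instance : (padicHaar p).IsAddHaarMeasure := by
  unfold padicHaar; infer_instance

theorem padicHaar_closedBall_zero_one : padicHaar p (closedBall 0 1) = 1 :=
  Measure.addHaarMeasure_self (K₀ := unitBall p)

theorem padicHaar_closedBall_center (x : ℚ_[p]) (r : ℝ) :
    padicHaar p (closedBall x r) = padicHaar p (closedBall 0 r) := by
  have h : (fun y => x + y) ⁻¹' closedBall x r = closedBall 0 r := by
    ext y; simp
  rw [← h, measure_preimage_add]

theorem closedBall_eq_iUnion_closedBall_natCast (n : ℕ) :
    closedBall (0 : ℚ_[p]) 1 =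
      ⋃ i : Fin (p ^ n), closedBall ((i : ℕ) : ℚ_[p]) ((p : ℝ) ^ (-(n : ℤ))) := by
  ext x
  simp only [mem_closedBall, Set.mem_iUnion, dist_eq_norm, sub_zero]
  constructor
  · intro hx
    have h := PadicInt.appr_spec n (⟨x, hx⟩ : ℤ_[p])
    rw [← PadicInt.norm_le_pow_iff_mem_span_pow] at h
    exact ⟨⟨_, PadicInt.appr_lt ⟨x, hx⟩ n⟩, by
      rw [PadicInt.norm_def] at h; exact h⟩
  · rintro ⟨i, hi⟩
    have h1 : ‖x - ((i : ℕ) : ℚ_[p])‖ ≤ 1 := hi.trans <| by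
      rw [zpow_neg, zpow_natCast]
      exact inv_le_one_of_one_le₀ (one_le_pow₀ one_lt_cast_prime.le)
    have h2 : ‖((i : ℕ) : ℚ_[p])‖ ≤ 1 := by
      simpa using Padic.norm_int_le_one (p := p) ((i : ℕ) : ℤ)
    calc ‖x‖ = ‖(x - ((i : ℕ) : ℚ_[p])) + ((i : ℕ) : ℚ_[p])‖ := by rw [sub_add_cancel]
      _ ≤ _ := (Padic.nonarchimedean _ _).trans (max_le h1 h2)

/-- `ℤ_p` is the disjoint union of `p ^ n` translates of this ball, one for each residue modulo `p ^
n`. -/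
theorem padicHaar_closedBall (x : ℚ_[p]) (n : ℕ) :
    padicHaar p (closedBall x ((p : ℝ) ^ (-(n : ℤ)))) = ENNReal.ofReal ((p : ℝ) ^ (-(n : ℤ))) := by
  have hd : Pairwise (Function.onFun Disjoint fun i : Fin (p ^ n) =>
      closedBall ((i : ℕ) : ℚ_[p]) ((p : ℝ) ^ (-(n : ℤ)))) := by
    intro i j hij
    rcases IsUltrametricDist.closedBall_eq_or_disjoint ((i : ℕ) : ℚ_[p]) ((j : ℕ) : ℚ_[p])
      ((p : ℝ) ^ (-(n : ℤ))) with h | h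
    · exfalso
      have h1 : ((i : ℕ) : ℚ_[p]) ∈ closedBall ((j : ℕ) : ℚ_[p]) ((p : ℝ) ^ (-(n : ℤ))) := by
        rw [← h]; exact mem_closedBall_self (zpow_nonneg cast_prime_pos.le _)
      rw [mem_closedBall, dist_eq_norm] at h1
      have h2 := (Padic.norm_int_le_pow_iff_dvd (p := p) ((i : ℕ) - (j : ℕ) : ℤ) n).1
        (by push_cast; exact h1)
      apply hij
      apply Fin.ext
      have h3 : ((j : ℕ)) ≡ (i : ℕ) [MOD p ^ n] :=
        Nat.modEq_iff_dvd.2 (by push_cast; exact h2)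
      exact (h3.eq_of_lt_of_lt j.2 i.2).symm
    · exact h
  have h := padicHaar_closedBall_zero_one (p := p)
  rw [closedBall_eq_iUnion_closedBall_natCast n,
    measure_iUnion hd (fun _ => isClosed_closedBall.measurableSet)] at h
  simp only [padicHaar_closedBall_center (p := p) (((_ : Fin (p ^ n)) : ℕ) : ℚ_[p]), tsum_fintype,
    Finset.sum_const, Finset.card_univ, Fintype.card_fin, nsmul_eq_mul] at h
  rw [padicHaar_closedBall_center, zpow_neg, zpow_natCast,
    ENNReal.ofReal_inv_of_pos (pow_pos cast_prime_pos n), ENNReal.ofReal_pow cast_prime_pos.le,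
    ENNReal.ofReal_natCast]
  rw [zpow_neg, zpow_natCast] at h
  push_cast at h
  exact ENNReal.eq_inv_of_mul_eq_one_left (by rw [mul_comm]; exact h)

theorem le_zpow_of_lt_zpow_succ {x : ℚ_[p]} {n : ℤ} (h : ‖x‖ < (p : ℝ) ^ (n + 1)) :
    ‖x‖ ≤ (p : ℝ) ^ n := (Padic.norm_le_pow_iff_norm_lt_pow_add_one x n).2 h

/-- Distances are powers of `p`, so a set of diameter in `[p ^ m, p ^ (m + 1))` lies in a ball of
radius `p ^ m`. This is the mass distribution bound needed for comparison with Hausdorff measure. -/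
theorem padicHaar_le_ediam {s : Set ℚ_[p]} (hs : ediam s ≤ 1) : padicHaar p s ≤ ediam s := by
  rcases s.eq_empty_or_nonempty with rfl | ⟨x, hx⟩
  · simp
  have hfin : ediam s ≠ ⊤ := (hs.trans_lt ENNReal.one_lt_top).ne
  have hdist : ∀ y ∈ s, ENNReal.ofReal ‖y - x‖ ≤ ediam s := by
    intro y hy
    have := edist_le_ediam_of_mem hy hx
    rwa [edist_dist, dist_eq_norm] at this
  have hd : ∀ y ∈ s, ‖y - x‖ ≤ (ediam s).toReal := fun y hy =>
    (ENNReal.ofReal_le_iff_le_toReal hfin).1 (hdist y hy)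
  set δ := (ediam s).toReal with hδ
  have hδ1 : δ ≤ 1 := by simpa using ENNReal.toReal_mono ENNReal.one_ne_top hs
  rcases (ENNReal.toReal_nonneg : 0 ≤ (ediam s).toReal).eq_or_lt with h0 | h0
  -- At diameter zero the set lies in balls of arbitrarily small measure.
  · rw [← hδ] at h0
    have hle : ∀ n : ℕ, padicHaar p s ≤ ENNReal.ofReal ((p : ℝ) ^ (-(n : ℤ))) := by
      intro n
      rw [← padicHaar_closedBall x n]
      refine measure_mono fun y hy => ?_
      rw [mem_closedBall, dist_eq_norm]
      exact (hd y hy).trans (h0 ▸ zpow_nonneg cast_prime_pos.le _)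
    have ht : Tendsto (fun n : ℕ => ENNReal.ofReal ((p : ℝ) ^ (-(n : ℤ)))) atTop (𝓝 0) := by
      rw [← ENNReal.ofReal_zero]
      refine ENNReal.tendsto_ofReal ?_
      simpa [inv_pow] using tendsto_pow_atTop_nhds_zero_of_lt_one
        (inv_nonneg.2 (cast_prime_pos (p := p)).le) (inv_lt_one_of_one_lt₀ one_lt_cast_prime)
    exact (ge_of_tendsto' ht hle).trans zero_le
  · obtain ⟨m, hm1, hm2⟩ := exists_mem_Ico_zpow h0 (one_lt_cast_prime (p := p))
    have hm0 : m ≤ 0 := by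
      by_contra! hcon
      have : (1 : ℝ) < (p : ℝ) ^ m := one_lt_zpow₀ one_lt_cast_prime hcon
      linarith
    obtain ⟨n, rfl⟩ : ∃ n : ℕ, m = -(n : ℤ) := ⟨m.natAbs, by omega⟩
    calc padicHaar p s ≤ padicHaar p (closedBall x ((p : ℝ) ^ (-(n : ℤ)))) := by
          refine measure_mono fun y hy => ?_
          rw [mem_closedBall, dist_eq_norm]
          exact le_zpow_of_lt_zpow_succ ((hd y hy).trans_lt hm2)
      _ = ENNReal.ofReal ((p : ℝ) ^ (-(n : ℤ))) := padicHaar_closedBall x n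
      _ ≤ ENNReal.ofReal δ := ENNReal.ofReal_le_ofReal hm1
      _ = ediam s := ENNReal.ofReal_toReal hfin

theorem ediam_closedBall_zpow_le (x : ℚ_[p]) (n : ℤ) :
    ediam (closedBall x ((p : ℝ) ^ n)) ≤ ENNReal.ofReal ((p : ℝ) ^ n) := by
  refine ediam_le fun y hy z hz => ?_
  rw [edist_dist]
  refine ENNReal.ofReal_le_ofReal ?_
  rw [mem_closedBall] at hy hz
  exact (dist_triangle_max y x z).trans (max_le hy (by rwa [dist_comm]))

theorem hausdorffMeasure_closedBall_zero_one_le : μH[1] (closedBall (0 : ℚ_[p]) 1) ≤ 1 := by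
  have ht : Tendsto (fun n : ℕ => ENNReal.ofReal ((p : ℝ) ^ (-(n : ℤ)))) atTop (𝓝 0) := by
    rw [← ENNReal.ofReal_zero]
    refine ENNReal.tendsto_ofReal ?_
    simpa [inv_pow] using tendsto_pow_atTop_nhds_zero_of_lt_one
      (inv_nonneg.2 (cast_prime_pos (p := p)).le) (inv_lt_one_of_one_lt₀ one_lt_cast_prime)
  have h := Measure.hausdorffMeasure_le_liminf_sum (β := ℕ) (ι := fun n => Fin (p ^ n)) 1
    (closedBall (0 : ℚ_[p]) 1) (l := atTop) _ ht
    (fun n i => closedBall ((i : ℕ) : ℚ_[p]) ((p : ℝ) ^ (-(n : ℤ))))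
    (Eventually.of_forall fun n i => ediam_closedBall_zpow_le _ _)
    (Eventually.of_forall fun n => (closedBall_eq_iUnion_closedBall_natCast n).le)
  refine h.trans ?_
  refine (liminf_le_liminf (v := fun _ => (1 : ℝ≥0∞)) (Eventually.of_forall fun n => ?_)).trans
    (by simp)
  calc ∑ i : Fin (p ^ n), ediam (closedBall ((i : ℕ) : ℚ_[p]) ((p : ℝ) ^ (-(n : ℤ)))) ^ (1 : ℝ)
      ≤ ∑ i : Fin (p ^ n), ENNReal.ofReal ((p : ℝ) ^ (-(n : ℤ))) := by
        refine Finset.sum_le_sum fun i _ => ?_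
        rw [ENNReal.rpow_one]
        exact ediam_closedBall_zpow_le _ _
    _ = 1 := by
        rw [Finset.sum_const, Finset.card_univ, Fintype.card_fin, nsmul_eq_mul, zpow_neg,
          zpow_natCast, ENNReal.ofReal_inv_of_pos (pow_pos cast_prime_pos n),
          ENNReal.ofReal_pow cast_prime_pos.le, ENNReal.ofReal_natCast, Nat.cast_pow]
        exact ENNReal.mul_inv_cancel
          (pow_ne_zero _ (by exact_mod_cast (Fact.out : p.Prime).ne_zero)) (by finiteness)

/-- Hausdorff measure is translation invariant, and the two bounds above give `ℤ_p` mass one. The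
identification reduces changes of variables to statements about distances. -/
theorem padicHaar_eq_hausdorffMeasure : padicHaar p = (μH[1] : Measure ℚ_[p]) := by
  have hle : padicHaar p ≤ μH[1] :=
    Measure.le_hausdorffMeasure 1 _ 1 one_pos fun s hs => by
      rw [ENNReal.rpow_one]; exact padicHaar_le_ediam hs
  have h1 : μH[1] (closedBall (0 : ℚ_[p]) 1) = 1 :=
    le_antisymm hausdorffMeasure_closedBall_zero_one_le
      (padicHaar_closedBall_zero_one.symm.le.trans (hle _))
  have : (μH[1] : Measure ℚ_[p]).IsAddHaarMeasure :=
    Measure.isAddHaarMeasure_of_isCompact_nonempty_interior _ (closedBall 0 1)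
      (isCompact_closedBall 0 1)
      ⟨0, ball_subset_interior_closedBall (mem_ball_self one_pos)⟩ (by simp [h1]) (by simp [h1])
  exact (Measure.addHaarMeasure_eq_iff (unitBall p) _).2 h1

/-- The map is `r`-Lipschitz on `A` and its inverse is `r⁻¹`-Lipschitz; each bounds Hausdorff
measure in one direction. No measurability of `A` is needed. -/
theorem padicHaar_image {f : ℚ_[p] → ℚ_[p]} {A : Set ℚ_[p]} {r : ℝ≥0} (hr : r ≠ 0)
    (h : ∀ x ∈ A, ∀ y ∈ A, ‖f x - f y‖ = r * ‖x - y‖) :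
    padicHaar p (f '' A) = r * padicHaar p A := by
  have hr' : 0 < (r : ℝ) := NNReal.coe_pos.2 (pos_iff_ne_zero.2 hr)
  have hinj : Set.InjOn f A := by
    intro x hx y hy hxy
    have h1 := h x hx y hy
    rw [hxy, sub_self, norm_zero, zero_eq_mul] at h1
    exact sub_eq_zero.1 (norm_eq_zero.1 (h1.resolve_left hr'.ne'))
  rw [padicHaar_eq_hausdorffMeasure]
  apply le_antisymm
  · have hl : LipschitzOnWith r f A := LipschitzOnWith.of_dist_le_mul fun x hx y hy => by
      rw [dist_eq_norm, dist_eq_norm, h x hx y hy]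
    simpa using hl.hausdorffMeasure_image_le zero_le_one
  · have hl : LipschitzOnWith r⁻¹ (Function.invFunOn f A) (f '' A) := by
      refine LipschitzOnWith.of_dist_le_mul ?_
      rintro _ ⟨x, hx, rfl⟩ _ ⟨y, hy, rfl⟩
      rw [hinj.leftInvOn_invFunOn hx, hinj.leftInvOn_invFunOn hy, dist_eq_norm, dist_eq_norm,
        h x hx y hy, NNReal.coe_inv, inv_mul_cancel_left₀ hr'.ne']
    have h2 := hl.hausdorffMeasure_image_le zero_le_one
    rw [hinj.invFunOn_image subset_rfl, ENNReal.rpow_one, ENNReal.coe_inv hr] at h2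
    calc (r : ℝ≥0∞) * μH[1] A ≤ r * ((r : ℝ≥0∞)⁻¹ * μH[1] (f '' A)) := by gcongr
      _ = μH[1] (f '' A) := by
        rw [← mul_assoc, ENNReal.mul_inv_cancel (by exact_mod_cast hr) ENNReal.coe_ne_top, one_mul]

/-! ### Change of variables for fractional linear maps -/

/-- A change of variables without derivatives: the level sets of `r` are countably many, and on each
one `f` dilates distances by exactly the constant value of `r`. -/
theorem map_withDensity_padicHaar {f : ℚ_[p] → ℚ_[p]} (hf : Measurable f) {S : Set ℚ_[p]}
    (hS : MeasurableSet S) (hinj : Set.InjOn f S) {r : ℚ_[p] → ℝ≥0} (hr : Measurable r)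
    (hc : (Set.range r).Countable) (hr0 : ∀ x ∈ S, r x ≠ 0)
    (h : ∀ x ∈ S, ∀ y ∈ S, r x = r y → ‖f x - f y‖ = r x * ‖x - y‖) :
    (((padicHaar p).restrict S).withDensity (fun x => (r x : ℝ≥0∞))).map f =
      (padicHaar p).restrict (f '' S) := by
  have := hc.to_subtype
  ext A hA
  let B : Set.range r → Set ℚ_[p] := fun c => (f ⁻¹' A ∩ S) ∩ r ⁻¹' {(c : ℝ≥0)}
  have hBm : ∀ c, MeasurableSet (B c) := fun c =>
    ((hf hA).inter hS).inter (hr (measurableSet_singleton _))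
  have hBS : ∀ c, B c ⊆ S := fun c x hx => hx.1.2
  have hU : f ⁻¹' A ∩ S = ⋃ c, B c := by
    ext x
    simp [B]
  have hBd : Pairwise (Function.onFun Disjoint B) := by
    intro c d hcd
    refine Set.disjoint_left.2 fun x hx hx' => hcd (Subtype.ext ?_)
    exact hx.2.symm.trans hx'.2
  have hid : Pairwise (Function.onFun Disjoint fun c => f '' B c) := by
    intro c d hcd
    refine Set.disjoint_left.2 ?_
    rintro _ ⟨x, hx, rfl⟩ ⟨y, hy, hxy⟩
    rw [hinj (hBS _ hy) (hBS _ hx) hxy] at hy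
    exact Set.disjoint_left.1 (hBd hcd) hx hy
  have hpiece : ∀ c, ∫⁻ x in B c, r x ∂(padicHaar p) = padicHaar p (f '' B c) := by
    intro c
    rcases (B c).eq_empty_or_nonempty with h0 | ⟨x₀, hx₀⟩
    · simp [h0]
    have hc0 : (c : ℝ≥0) ≠ 0 := by
      rw [← show r x₀ = c from hx₀.2]
      exact hr0 _ (hBS _ hx₀)
    rw [padicHaar_image (r := c) hc0 (fun x hx y hy => by
      rw [h x (hBS _ hx) y (hBS _ hy) (hx.2.trans hy.2.symm), show r x = c from hx.2])]
    rw [← setLIntegral_const]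
    exact setLIntegral_congr_fun (hBm c) fun x hx => by rw [show r x = c from hx.2]
  rw [Measure.map_apply hf hA, withDensity_apply _ (hf hA), Measure.restrict_restrict (hf hA), hU,
    lintegral_iUnion hBm hBd, Measure.restrict_apply hA]
  simp_rw [hpiece]
  rw [← measure_iUnion hid fun c => (hBm c).image_of_measurable_injOn hf (hinj.mono (hBS c)),
    ← Set.image_iUnion, ← hU, Set.image_preimage_inter]

theorem countable_range_comp_norm {α : Type*} (g : ℝ → α) :
    (Set.range fun x : ℚ_[p] => g ‖x‖).Countable := by
  have h : (Set.range fun x : ℚ_[p] => ‖x‖).Countable := by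
    refine (Set.countable_range fun q : ℚ => (q : ℝ)).mono ?_
    rintro _ ⟨x, rfl⟩
    exact ⟨padicNormE x, rfl⟩
  have : (Set.range fun x : ℚ_[p] => g ‖x‖) = g '' Set.range fun x : ℚ_[p] => ‖x‖ := by
    rw [← Set.range_comp]; rfl
  rw [this]
  exact h.image g

/-- The difference of two values is `(a e - b c) (x - y) / ((c x + e) (c y + e))`, an exact dilation
wherever `|c x + e|` is constant, and `p`-adic norms take countably many values. -/
theorem map_mobius_padicHaar {a b c e : ℚ_[p]} (hD : a * e - b * c ≠ 0) {S : Set ℚ_[p]}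
    (hS : MeasurableSet S) (hS0 : ∀ x ∈ S, c * x + e ≠ 0) :
    (((padicHaar p).restrict S).withDensity
      (fun x => ((‖a * e - b * c‖₊ / ‖c * x + e‖₊ ^ 2 : ℝ≥0) : ℝ≥0∞))).map
        (fun x => (a * x + b) / (c * x + e)) =
      (padicHaar p).restrict ((fun x => (a * x + b) / (c * x + e)) '' S) := by
  have hkey : ∀ x ∈ S, ∀ y ∈ S, (a * x + b) / (c * x + e) - (a * y + b) / (c * y + e) =
      (a * e - b * c) / ((c * x + e) * (c * y + e)) * (x - y) := by
    intro x hx y hy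
    have h1 := hS0 x hx
    have h2 := hS0 y hy
    rw [div_sub_div _ _ h1 h2, div_mul_eq_mul_div]
    congr 1
    ring
  refine map_withDensity_padicHaar ?_ hS ?_ ?_ ?_ ?_ ?_
  · exact Measurable.div (by fun_prop) (by fun_prop)
  · intro x hx y hy hxy
    have h := hkey x hx y hy
    rw [sub_eq_zero.2 hxy, zero_eq_mul] at h
    exact sub_eq_zero.1 (h.resolve_left
      (div_ne_zero hD (mul_ne_zero (hS0 x hx) (hS0 y hy))))
  · fun_prop
  · refine (countable_range_comp_norm (p := p)
      (fun t => ‖a * e - b * c‖₊ / t.toNNReal ^ 2)).mono ?_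
    rintro _ ⟨x, rfl⟩
    exact ⟨c * x + e, by simp⟩
  · intro x hx
    exact div_ne_zero (nnnorm_ne_zero_iff.2 hD) (pow_ne_zero _ (nnnorm_ne_zero_iff.2 (hS0 x hx)))
  · intro x hx y hy hxy
    have hx0 : 0 < ‖c * x + e‖ := norm_pos_iff.2 (hS0 x hx)
    have hy0 : 0 < ‖c * y + e‖ := norm_pos_iff.2 (hS0 y hy)
    have hD' : 0 < ‖a * e - b * c‖ := norm_pos_iff.2 hD
    have h1 : ‖c * x + e‖ = ‖c * y + e‖ := by
      have h2 := congrArg (fun t : ℝ≥0 => (t : ℝ)) hxy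
      simp only [NNReal.coe_div, NNReal.coe_pow, coe_nnnorm] at h2
      rw [div_eq_div_iff (by positivity) (by positivity), mul_right_inj' hD'.ne',
        pow_left_inj₀ hy0.le hx0.le two_ne_zero] at h2
      exact h2.symm
    rw [hkey x hx y hy, norm_mul, norm_div, norm_mul, ← h1]
    simp [sq]

instance : NullSingletonClass (padicHaar p) := by
  rw [padicHaar_eq_hausdorffMeasure]
  exact Measure.nullSingletonClass_hausdorff _ one_pos

/-! ### The invariant measures on the parameter lines and their masses -/

/-- The conditions on `d` under which `σ ↦ ‖1 + d σ²‖⁻¹` is the density of an invariant finite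
measure on the group of rotations whose parameters compose by `σ ⊕ a = (σ + a) / (1 - d a σ)`. -/
structure IsAxisParam (d : ℚ_[p]) : Prop where
  ne_zero : d ≠ 0
  norm_of_le : ∀ x : ℚ_[p], ‖x‖ ≤ 1 → ‖1 + d * x ^ 2‖ = 1
  norm_of_lt : ∀ x : ℚ_[p], 1 < ‖x‖ → ‖1 + d * x ^ 2‖ = ‖d‖ * ‖x‖ ^ 2

theorem IsAxisParam.denom_ne_zero {d : ℚ_[p]} (hd : IsAxisParam d) (x : ℚ_[p]) :
    1 + d * x ^ 2 ≠ 0 := by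
  rw [← norm_ne_zero_iff]
  rcases le_or_gt ‖x‖ 1 with h | h
  · rw [hd.norm_of_le x h]; exact one_ne_zero
  · rw [hd.norm_of_lt x h]
    exact mul_ne_zero (norm_ne_zero_iff.2 hd.ne_zero) (pow_ne_zero _ (by linarith))

theorem norm_add_eq_left {x y : ℚ_[p]} (h : ‖y‖ < ‖x‖) : ‖x + y‖ = ‖x‖ := by
  rw [Padic.add_eq_max_of_ne h.ne', max_eq_left h.le]

theorem norm_two (hp : 2 < p) : ‖(2 : ℚ_[p])‖ = 1 := by
  have h : ‖((2 : ℤ) : ℤ_[p])‖ = 1 := by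
    refine le_antisymm (PadicInt.norm_le_one _) ?_
    by_contra! hlt
    have : ((p : ℕ) : ℤ) ∣ ((2 : ℕ) : ℤ) := (PadicInt.norm_int_lt_one_iff_dvd _).1 hlt
    have := Nat.le_of_dvd (by norm_num) (Int.natCast_dvd_natCast.1 this)
    omega
  rw [PadicInt.norm_def, PadicInt.coe_intCast] at h
  exact_mod_cast h

theorem isSquare_of_norm_sub_one_lt (hp : 2 < p) {u : ℚ_[p]} (hu : ‖u - 1‖ < 1) : IsSquare u := by
  have hu1 : ‖u‖ = 1 := by
    have := norm_add_eq_left (x := (1 : ℚ_[p])) (y := u - 1) (by simpa using hu)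
    simpa using this
  let y : ℤ_[p] := ⟨u, hu1.le⟩
  have h2 : ‖(2 : ℤ_[p])‖ = 1 := norm_two hp
  obtain ⟨z, hz, -⟩ := hensels_lemma (p := p) (R := ℤ_[p]) (a := (1 : ℤ_[p]))
    (F := (Polynomial.X ^ 2 - Polynomial.C y : Polynomial ℤ_[p])) (by
      have e1 : (Polynomial.aeval (1 : ℤ_[p]))
          (Polynomial.X ^ 2 - Polynomial.C y : Polynomial ℤ_[p]) = 1 - y := by simp
      have e2 : (Polynomial.aeval (1 : ℤ_[p]))
          (Polynomial.derivative (Polynomial.X ^ 2 - Polynomial.C y : Polynomial ℤ_[p])) = 2 := by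
        simp [one_add_one_eq_two]
      rw [e1, e2, h2, one_pow, norm_sub_rev]
      exact hu)
  have hz' : z ^ 2 = y := by simpa [sub_eq_zero] using hz
  refine ⟨(z : ℚ_[p]), ?_⟩
  have : ((z ^ 2 : ℤ_[p]) : ℚ_[p]) = u := by rw [hz']
  push_cast at this
  rw [← this, sq]

/-- If `1 - v x²` were a nonunit for integral `x`, then `v x²` would be congruent to one modulo `p`,
hence a square by Hensel, and so would `v`. For `|x| > 1` the quadratic term dominates. -/
theorem IsNonquadraticUnit.isAxisParam_neg (hp : 2 < p) {v : ℚ_[p]} (hv : IsNonquadraticUnit v) :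
    IsAxisParam (-v) := by
  have hv0 : v ≠ 0 := norm_ne_zero_iff.1 (by rw [hv.1]; exact one_ne_zero)
  refine ⟨neg_ne_zero.2 hv0, fun x hx => ?_, fun x hx => ?_⟩
  · have hle : ‖1 + -v * x ^ 2‖ ≤ 1 := by
      refine (Padic.nonarchimedean _ _).trans (max_le (by simp) ?_)
      rw [norm_mul, norm_neg, hv.1, one_mul, norm_pow]
      exact pow_le_one₀ (norm_nonneg _) hx
    refine hle.antisymm ?_
    by_contra! hlt
    have hs : IsSquare (v * x ^ 2) := by
      refine isSquare_of_norm_sub_one_lt hp ?_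
      rw [norm_sub_rev]
      simpa [sub_eq_add_neg] using hlt
    have hx0 : x ≠ 0 := by
      rintro rfl
      simp at hlt
    apply hv.2
    have : v = v * x ^ 2 * (x⁻¹) ^ 2 := by field_simp
    rw [this]
    exact hs.mul (IsSquare.sq _)
  · rw [add_comm, norm_add_eq_left]
    · simp
    · rw [norm_mul, norm_neg, hv.1, one_mul, norm_pow, norm_one]
      exact one_lt_pow₀ hx two_ne_zero

theorem cast_prime_le_of_one_lt_norm {x : ℚ_[p]} (hx : 1 < ‖x‖) : (p : ℝ) ≤ ‖x‖ := by
  by_contra! h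
  have := le_zpow_of_lt_zpow_succ (x := x) (n := 0) (by simpa using h)
  rw [zpow_zero] at this
  linarith

theorem isAxisParam_of_norm_eq_inv {d : ℚ_[p]} (hd : ‖d‖ = (p : ℝ)⁻¹) : IsAxisParam d := by
  have hp0 := cast_prime_pos (p := p)
  have hp1 := one_lt_cast_prime (p := p)
  refine ⟨norm_ne_zero_iff.1 (by rw [hd]; positivity), fun x hx => ?_, fun x hx => ?_⟩
  · rw [norm_add_eq_left, norm_one]
    rw [norm_mul, hd, norm_pow, norm_one]
    exact mul_lt_one_of_nonneg_of_lt_one_left (by positivity) (inv_lt_one_of_one_lt₀ hp1)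
      (pow_le_one₀ (norm_nonneg _) hx)
  · rw [add_comm, norm_add_eq_left, norm_mul, norm_pow]
    have := cast_prime_le_of_one_lt_norm hx
    rw [norm_mul, hd, norm_pow, norm_one, inv_mul_eq_div, one_lt_div hp0]
    nlinarith

/-- The measure `dσ / ‖1 + d σ²‖` on `ℚ_[p]`. -/
def axisMeasure (d : ℚ_[p]) : Measure ℚ_[p] :=
  (padicHaar p).withDensity fun x => ((1 / ‖1 + d * x ^ 2‖₊ : ℝ≥0) : ℝ≥0∞)

theorem measurable_axisDensity (d : ℚ_[p]) :
    Measurable fun x : ℚ_[p] => (1 / ‖1 + d * x ^ 2‖₊ : ℝ≥0) := by fun_prop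

theorem padicHaar_setOf_linear_eq_zero {c e : ℚ_[p]} (h : c ≠ 0 ∨ e ≠ 0) :
    padicHaar p {x | c * x + e = 0} = 0 := by
  refine Set.Subsingleton.measure_zero ?_ _
  intro x hx y hy
  simp only [Set.mem_ofPred_eq] at hx hy
  have hc : c ≠ 0 := by
    rintro rfl
    simp_all
  exact mul_left_cancel₀ hc (by linear_combination hx - hy)

/-- With `f x = (x + a) / (1 - d a x)` one has `1 + d f(x)² = (1 + d x²) (1 + d a²) / (1 - d a x)²`,
while the Jacobian of `f` is `|1 + d a²| / |1 - d a x|²`; the extra factors cancel. -/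
theorem measurePreserving_axisMeasure {d : ℚ_[p]} (hd : IsAxisParam d) (a : ℚ_[p]) :
    MeasurePreserving (fun x => (x + a) / (1 - d * a * x)) (axisMeasure d) (axisMeasure d) := by
  have hDa := hd.denom_ne_zero a
  set f : ℚ_[p] → ℚ_[p] := fun x => (1 * x + a) / (-(d * a) * x + 1) with hf
  have hff : (fun x => (x + a) / (1 - d * a * x)) = f := by
    funext x; simp only [hf]; congr 1 <;> ring
  have hfm : Measurable f := Measurable.div (by fun_prop) (by fun_prop)
  set S : Set ℚ_[p] := {x | -(d * a) * x + 1 ≠ 0}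
  have hS : MeasurableSet S :=
    (isOpen_ne_fun (by fun_prop) continuous_const).measurableSet
  have hSc : (padicHaar p).restrict S = padicHaar p := by
    rw [Measure.restrict_eq_self_of_ae_mem]
    rw [ae_iff]
    simpa [S] using padicHaar_setOf_linear_eq_zero (c := -(d * a)) (Or.inr one_ne_zero)
  have hD : (1 : ℚ_[p]) * 1 - a * -(d * a) ≠ 0 := by
    convert hDa using 1; ring
  -- The image misses at most the point where `d a y + 1 = 0`: elsewhere composition with the
  -- parameter `-a` supplies a preimage.
  have himg : (padicHaar p).restrict (f '' S) = padicHaar p := by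
    rw [Measure.restrict_eq_self_of_ae_mem]
    rw [ae_iff]
    refine measure_mono_null (fun y hy => ?_)
      (padicHaar_setOf_linear_eq_zero (c := d * a) (Or.inr one_ne_zero))
    by_contra hy'
    simp only [Set.mem_ofPred_eq] at hy hy'
    apply hy
    have h1 : -(d * a) * ((y - a) / (d * a * y + 1)) + 1 = (1 + d * a ^ 2) / (d * a * y + 1) := by
      rw [mul_div_assoc', div_add_one hy']
      congr 1
      ring
    refine ⟨(y - a) / (d * a * y + 1), ?_, ?_⟩
    · simp only [S, Set.mem_ofPred_eq]
      rw [h1]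
      exact div_ne_zero hDa hy'
    · simp only [hf]
      rw [h1, one_mul, div_add' _ _ _ hy', div_div_div_cancel_right₀ hy', div_eq_iff hDa]
      ring
  have key := map_mobius_padicHaar hD hS (fun x hx => hx)
  rw [hSc] at key
  change Measure.map f _ = (padicHaar p).restrict (f '' S) at key
  rw [himg] at key
  rw [hff]
  refine ⟨hfm, ?_⟩
  ext A hA
  have hw := (measurable_axisDensity d).coe_nnreal_ennreal
  rw [Measure.map_apply hfm hA, axisMeasure, withDensity_apply _ (hfm hA), withDensity_apply _ hA]
  conv_rhs => rw [← key]
  rw [setLIntegral_map hA hw hfm, restrict_withDensity (hfm hA)]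
  have hr : Measurable fun x : ℚ_[p] =>
      ((‖(1 : ℚ_[p]) * 1 - a * -(d * a)‖₊ / ‖-(d * a) * x + 1‖₊ ^ 2 : ℝ≥0) : ℝ≥0∞) := by fun_prop
  refine Eq.trans ?_ (lintegral_withDensity_eq_lintegral_mul _ hr (hw.comp hfm)).symm
  refine lintegral_congr_ae (ae_restrict_of_ae ?_)
  have hSae : ∀ᵐ x ∂(padicHaar p), x ∈ S := by
    rw [← hSc]; exact ae_restrict_mem hS
  filter_upwards [hSae] with x hx
  simp only [Pi.mul_apply, Function.comp]
  rw [← ENNReal.coe_mul, ENNReal.coe_inj]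
  have e1 : 1 + d * (f x) ^ 2 = (1 + d * x ^ 2) * (1 + d * a ^ 2) / (-(d * a) * x + 1) ^ 2 := by
    have hx' : -(d * a) * x + 1 ≠ 0 := hx
    simp only [hf]
    rw [div_pow, mul_div_assoc', eq_div_iff (pow_ne_zero 2 hx'), add_mul,
      div_mul_cancel₀ _ (pow_ne_zero 2 hx')]
    ring
  have e2 : (1 : ℚ_[p]) * 1 - a * -(d * a) = 1 + d * a ^ 2 := by ring
  have n1 : ‖1 + d * x ^ 2‖₊ ≠ 0 := nnnorm_ne_zero_iff.2 (hd.denom_ne_zero x)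
  have n2 : ‖1 + d * a ^ 2‖₊ ≠ 0 := nnnorm_ne_zero_iff.2 hDa
  have n3 : ‖-(d * a) * x + 1‖₊ ≠ 0 := nnnorm_ne_zero_iff.2 hx
  rw [e1, e2, nnnorm_div, nnnorm_mul, nnnorm_pow]
  generalize ‖-(d * a) * x + 1‖₊ = t at n3 ⊢
  field_simp

theorem axisMeasure_restrict_closedBall {d : ℚ_[p]} (hd : IsAxisParam d) :
    (axisMeasure d).restrict (closedBall 0 1) = (padicHaar p).restrict (closedBall 0 1) := by
  rw [axisMeasure, restrict_withDensity isClosed_closedBall.measurableSet]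
  conv_rhs => rw [← withDensity_one (μ := (padicHaar p).restrict (closedBall 0 1))]
  refine withDensity_congr_ae ?_
  filter_upwards [ae_restrict_mem isClosed_closedBall.measurableSet] with x hx
  have : ‖1 + d * x ^ 2‖₊ = 1 := NNReal.eq (hd.norm_of_le x (by simpa using hx))
  simp [this]

/-- Outside `ℤ_p` the density is `1 / (|d| |x|²)`, exactly the Jacobian of the inversion. The image
omits only the null point `0`. -/
theorem map_inversion_axisMeasure {d : ℚ_[p]} (hd : IsAxisParam d) :
    ((axisMeasure d).restrict (closedBall 0 1)ᶜ).map (fun x => 1 / (d * x)) =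
      (padicHaar p).restrict {x | ‖d‖ * ‖x‖ < 1} := by
  have hd0 := hd.ne_zero
  have hS : MeasurableSet (closedBall (0 : ℚ_[p]) 1)ᶜ := isClosed_closedBall.measurableSet.compl
  have hS1 : ∀ x ∈ (closedBall (0 : ℚ_[p]) 1)ᶜ, 1 < ‖x‖ := by intro x hx; simpa using hx
  have hS0 : ∀ x ∈ (closedBall (0 : ℚ_[p]) 1)ᶜ, d * x + 0 ≠ 0 := by
    intro x hx
    have h1 := hS1 x hx
    rw [add_zero]
    exact mul_ne_zero hd0 (norm_pos_iff.1 (by linarith))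
  have key := map_mobius_padicHaar (a := 0) (b := 1) (c := d) (e := 0) (by simpa using hd0) hS hS0
  have e1 : (fun x : ℚ_[p] => (0 * x + 1) / (d * x + 0)) = fun x => 1 / (d * x) := by
    funext x; simp
  rw [e1] at key
  have hden : (axisMeasure d).restrict (closedBall 0 1)ᶜ =
      ((padicHaar p).restrict (closedBall 0 1)ᶜ).withDensity
        (fun x => ((‖0 * 0 - 1 * d‖₊ / ‖d * x + 0‖₊ ^ 2 : ℝ≥0) : ℝ≥0∞)) := by
    rw [axisMeasure, restrict_withDensity hS]
    refine withDensity_congr_ae ?_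
    filter_upwards [ae_restrict_mem hS] with x hx
    have h1 := hS1 x hx
    have h2 : ‖1 + d * x ^ 2‖₊ = ‖d‖₊ * ‖x‖₊ ^ 2 := NNReal.eq (by simpa using hd.norm_of_lt x h1)
    have n1 : ‖d‖₊ ≠ 0 := nnnorm_ne_zero_iff.2 hd0
    have n2 : ‖x‖₊ ≠ 0 := nnnorm_ne_zero_iff.2 (norm_pos_iff.1 (by linarith))
    rw [h2, ENNReal.coe_inj]
    simp only [mul_zero, one_mul, zero_sub, nnnorm_neg, add_zero, nnnorm_mul]
    field_simp
  rw [hden, key]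
  refine Measure.restrict_congr_set ?_
  have h0 : ∀ᵐ x ∂(padicHaar p), x ≠ 0 := by simp [ae_iff]
  filter_upwards [h0] with y hy
  have hdp : 0 < ‖d‖ := norm_pos_iff.2 hd0
  have hyp : 0 < ‖y‖ := norm_pos_iff.2 hy
  refine propext ⟨?_, fun h => ⟨1 / (d * y), ?_, ?_⟩⟩
  · rintro ⟨x, hx, rfl⟩
    have h1 := hS1 x hx
    change ‖d‖ * ‖1 / (d * x)‖ < 1
    rw [norm_div, norm_one, norm_mul, mul_one_div, div_mul_eq_div_div, div_self hdp.ne',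
      div_lt_one (by linarith)]
    exact h1
  · change ‖d‖ * ‖y‖ < 1 at h
    simp only [Set.mem_compl_iff, mem_closedBall, dist_zero_right, not_le]
    rw [norm_div, norm_one, norm_mul, one_lt_div (by positivity)]
    exact h
  · simp only
    field_simp

theorem axisMeasure_univ_eq {d : ℚ_[p]} (hd : IsAxisParam d) :
    axisMeasure d Set.univ = 1 + padicHaar p {x | ‖d‖ * ‖x‖ < 1} := by
  have hm : Measurable fun x : ℚ_[p] => 1 / (d * x) := measurable_const.div (measurable_const_mul d)
  rw [← measure_add_measure_compl (isClosed_closedBall (x := (0 : ℚ_[p]) ) (ε := 1)).measurableSet]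
  congr 1
  · rw [← Measure.restrict_apply_self, axisMeasure_restrict_closedBall hd,
      Measure.restrict_apply_self, padicHaar_closedBall_zero_one]
  · have h := congrArg (fun m => m Set.univ) (map_inversion_axisMeasure hd)
    rw [Measure.map_apply hm MeasurableSet.univ] at h
    simpa using h

theorem axisMeasure_univ_of_norm_eq_one {d : ℚ_[p]} (hd : IsAxisParam d) (h : ‖d‖ = 1) :
    axisMeasure d Set.univ = ENNReal.ofReal (1 + 1 / p) := by
  -- The open unit ball is `p ℤ_p`, of mass `1/p`.
  have hs : {x : ℚ_[p] | ‖d‖ * ‖x‖ < 1} = closedBall 0 ((p : ℝ) ^ (-((1 : ℕ) : ℤ))) := by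
    ext x
    simp only [h, one_mul, Set.mem_ofPred_eq, mem_closedBall, dist_zero_right]
    rw [Padic.norm_le_pow_iff_norm_lt_pow_add_one]
    simp
  rw [axisMeasure_univ_eq hd, hs, padicHaar_closedBall,
    ENNReal.ofReal_add zero_le_one (by positivity)]
  simp

theorem setOf_norm_mul_lt_one {d : ℚ_[p]} (h : ‖d‖ = (p : ℝ)⁻¹) :
    {x : ℚ_[p] | ‖d‖ * ‖x‖ < 1} = closedBall 0 1 := by
  ext x
  simp only [h, Set.mem_ofPred_eq, mem_closedBall, dist_zero_right]
  rw [inv_mul_lt_one₀ cast_prime_pos, ← zpow_zero (p : ℝ),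
    Padic.norm_le_pow_iff_norm_lt_pow_add_one]
  simp

theorem axisMeasure_univ_of_norm_eq_inv {d : ℚ_[p]} (h : ‖d‖ = (p : ℝ)⁻¹) :
    axisMeasure d Set.univ = 2 := by
  rw [axisMeasure_univ_eq (isAxisParam_of_norm_eq_inv h), setOf_norm_mul_lt_one h,
    padicHaar_closedBall_zero_one, one_add_one_eq_two]

/-! ### Averaging over random translates in a group -/

theorem measurePreserving_mul_prod {G Ω : Type*} [Group G] [MeasurableSpace G] [MeasurableMul₂ G]
    [MeasurableSpace Ω] (μ : Measure G) [SFinite μ] [μ.IsMulLeftInvariant] (σ : Measure Ω)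
    [IsProbabilityMeasure σ] {ρ : Ω → G} (hρ : Measurable ρ) :
    MeasurePreserving (fun z : G × Ω => ρ z.2 * z.1) (μ.prod σ) μ := by
  have hm : Measurable fun z : G × Ω => ρ z.2 * z.1 := by fun_prop
  refine ⟨hm, ?_⟩
  ext A hA
  rw [Measure.map_apply hm hA, Measure.prod_apply_symm (hm hA)]
  have : ∀ ω, μ ((fun R => (R, ω)) ⁻¹' ((fun z : G × Ω => ρ z.2 * z.1) ⁻¹' A)) = μ A :=
    fun ω => measure_preimage_mul μ (ρ ω) A
  simp [this]

theorem measurePreserving_mul_prod_right {G Ω : Type*} [Group G] [MeasurableSpace G]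
    [MeasurableMul₂ G] [MeasurableSpace Ω] (μ : Measure G) [SFinite μ] [μ.IsMulRightInvariant]
    (σ : Measure Ω) [IsProbabilityMeasure σ] {ρ : Ω → G} (hρ : Measurable ρ) :
    MeasurePreserving (fun z : G × Ω => z.1 * ρ z.2) (μ.prod σ) μ := by
  have hm : Measurable fun z : G × Ω => z.1 * ρ z.2 := by fun_prop
  refine ⟨hm, ?_⟩
  ext A hA
  rw [Measure.map_apply hm hA, Measure.prod_apply_symm (hm hA)]
  have : ∀ ω, μ ((fun R => (R, ω)) ⁻¹' ((fun z : G × Ω => z.1 * ρ z.2) ⁻¹' A)) = μ A :=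
    fun ω => measure_preimage_mul_right μ (ρ ω) A
  simp [this]

theorem integral_eq_integral_integral_of_measurePreserving {G Ω : Type*} [MeasurableSpace G]
    [MeasurableSpace Ω] {μ : Measure G} [SFinite μ] {σ : Measure Ω} [SFinite σ] {T : G × Ω → G}
    (hT : MeasurePreserving T (μ.prod σ) μ) {ψ : G → ℂ} (hψ : Integrable ψ μ) :
    (∀ᵐ R ∂μ, Integrable (fun ω => ψ (T (R, ω))) σ) ∧
      ∫ R, ψ R ∂μ = ∫ R, ∫ ω, ψ (T (R, ω)) ∂σ ∂μ := by
  have hi : Integrable (fun z => ψ (T z)) (μ.prod σ) := hT.integrable_comp_of_integrable hψ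
  refine ⟨hi.prod_right_ae, ?_⟩
  rw [← integral_prod _ hi]
  have h1 : AEStronglyMeasurable ψ (Measure.map T (μ.prod σ)) := by
    rw [hT.map_eq]; exact hψ.aestronglyMeasurable
  conv_lhs => rw [← hT.map_eq]
  rw [integral_map hT.measurable.aemeasurable h1]

/-- A right translate of `μ` is again a Haar probability measure, so uniqueness applies. -/
theorem isMulRightInvariant_of_isProbabilityMeasure {G : Type*} [Group G] [TopologicalSpace G]
    [IsTopologicalGroup G] [LocallyCompactSpace G] [MeasurableSpace G] [BorelSpace G]
    (μ : Measure G) [μ.IsHaarMeasure] [IsProbabilityMeasure μ] : μ.IsMulRightInvariant := by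
  refine ⟨fun g => ?_⟩
  have hm : Measurable fun x : G => x * g := (continuous_mul_const g).measurable
  have : IsProbabilityMeasure (μ.map (· * g)) := Measure.isProbabilityMeasure_map hm.aemeasurable
  exact Measure.isHaarMeasure_eq_of_isProbabilityMeasure _ _

/-! ### Topology and matrix coordinates of `SO(3)_p` -/

variable {v : ℚ_[p]}

theorem isClosed_SO3 (v : ℚ_[p]) :
    IsClosed ((SO3 v : Subgroup _) : Set (Matrix.SpecialLinearGroup (Fin 3) ℚ_[p])) := by
  have hc : Continuous fun L : Matrix.SpecialLinearGroup (Fin 3) ℚ_[p] =>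
      (L : Matrix (Fin 3) (Fin 3) ℚ_[p]) := continuous_subtype_val
  exact isClosed_eq ((hc.matrix_transpose.mul continuous_const).mul hc) continuous_const

theorem isClosedEmbedding_coe_SO3 (v : ℚ_[p]) :
    IsClosedEmbedding fun R : SO3 v => ((R : Matrix.SpecialLinearGroup (Fin 3) ℚ_[p]) :
      Matrix (Fin 3) (Fin 3) ℚ_[p]) :=
  Matrix.SpecialLinearGroup.isClosedEmbedding_val.comp (isClosed_SO3 v).isClosedEmbedding_subtypeVal

instance (v : ℚ_[p]) : LocallyCompactSpace (SO3 v) := by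
  have : LocallyCompactSpace (Matrix (Fin 3) (Fin 3) ℚ_[p]) :=
    inferInstanceAs (LocallyCompactSpace (Fin 3 → Fin 3 → ℚ_[p]))
  exact (isClosedEmbedding_coe_SO3 v).locallyCompactSpace

instance (v : ℚ_[p]) : SecondCountableTopology (SO3 v) := by
  have : SecondCountableTopology (Matrix (Fin 3) (Fin 3) ℚ_[p]) :=
    inferInstanceAs (SecondCountableTopology (Fin 3 → Fin 3 → ℚ_[p]))
  exact (isClosedEmbedding_coe_SO3 v).isEmbedding.secondCountableTopology

/-- The matrix of an element of `SO(3)_p`. -/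
def SO3.mat (R : SO3 v) : Matrix (Fin 3) (Fin 3) ℚ_[p] :=
  ((R : Matrix.SpecialLinearGroup (Fin 3) ℚ_[p]) : Matrix (Fin 3) (Fin 3) ℚ_[p])

theorem SO3.mat_injective : Function.Injective (SO3.mat (v := v)) :=
  (isClosedEmbedding_coe_SO3 v).injective

@[simp]
theorem SO3.mat_mul (R S : SO3 v) : SO3.mat (R * S) = SO3.mat R * SO3.mat S := rfl

@[simp]
theorem SO3.mat_one : SO3.mat (1 : SO3 v) = 1 := rfl

theorem SO3.det_mat (R : SO3 v) : (SO3.mat R).det = 1 := R.1.2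

theorem SO3.transpose_mul_form_mul (R : SO3 v) :
    (SO3.mat R).transpose * formMatrix v * SO3.mat R = formMatrix v := R.2

theorem SO3.continuous_mat : Continuous (SO3.mat (v := v)) :=
  (isClosedEmbedding_coe_SO3 v).continuous

theorem SO3.continuous_iff {X : Type*} [TopologicalSpace X] {f : X → SO3 v} :
    Continuous f ↔ Continuous fun x => SO3.mat (f x) :=
  (isClosedEmbedding_coe_SO3 v).isEmbedding.isInducing.continuous_iff

@[simp]
theorem mat_rotZ (hv : IsVParam v) (α : OnePoint ℚ_[p]) : SO3.mat (rotZ hv α) = matZ v α := rfl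

@[simp]
theorem mat_rotY (β : OnePoint ℚ_[p]) : SO3.mat (rotY v β) = matY β := rfl

@[simp]
theorem mat_rotX (hv : IsVParam v) (γ : OnePoint ℚ_[p]) : SO3.mat (rotX hv γ) = matX v γ := rfl

theorem matZ_coe (a : ℚ_[p]) : matZ v (a : OnePoint ℚ_[p]) =
    !![(1 + v * a ^ 2) / (1 - v * a ^ 2), 2 * v * a / (1 - v * a ^ 2), 0;
       2 * a / (1 - v * a ^ 2), (1 + v * a ^ 2) / (1 - v * a ^ 2), 0;
       0, 0, 1] := rfl

theorem matY_coe (b : ℚ_[p]) : matY (b : OnePoint ℚ_[p]) =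
    !![(1 - p * b ^ 2) / (1 + p * b ^ 2), 0, -(2 * p * b) / (1 + p * b ^ 2);
       0, 1, 0;
       2 * b / (1 + p * b ^ 2), 0, (1 - p * b ^ 2) / (1 + p * b ^ 2)] := rfl

theorem matX_coe (c : ℚ_[p]) : matX v (c : OnePoint ℚ_[p]) =
    !![1, 0, 0;
       0, (1 + p / v * c ^ 2) / (1 - p / v * c ^ 2), 2 * (p / v) * c / (1 - p / v * c ^ 2);
       0, 2 * c / (1 - p / v * c ^ 2), (1 + p / v * c ^ 2) / (1 - p / v * c ^ 2)] := rfl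

theorem matZ_infty : matZ v OnePoint.infty = !![-1, 0, 0; 0, -1, 0; 0, 0, 1] := rfl

theorem matX_infty : matX v OnePoint.infty = !![1, 0, 0; 0, -1, 0; 0, 0, -1] := rfl

theorem continuous_rotZ_coe (hv : IsVParam v) :
    Continuous fun a : ℚ_[p] => rotZ hv (a : OnePoint ℚ_[p]) := by
  rw [SO3.continuous_iff]
  refine continuous_matrix fun i j => ?_
  simp only [mat_rotZ, matZ_coe]
  have h := denomZ_ne_zero hv
  fin_cases i <;> fin_cases j <;> simp <;> fun_prop (disch := exact h _)

theorem continuous_rotY_coe :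
    Continuous fun b : ℚ_[p] => rotY v (b : OnePoint ℚ_[p]) := by
  rw [SO3.continuous_iff]
  refine continuous_matrix fun i j => ?_
  simp only [mat_rotY, matY_coe]
  have h := denomY_ne_zero (p := p)
  fin_cases i <;> fin_cases j <;> simp <;> fun_prop (disch := exact h _)

theorem continuous_rotX_coe (hv : IsVParam v) :
    Continuous fun c : ℚ_[p] => rotX hv (c : OnePoint ℚ_[p]) := by
  rw [SO3.continuous_iff]
  refine continuous_matrix fun i j => ?_
  simp only [mat_rotX, matX_coe]
  have h := denomX_ne_zero hv
  fin_cases i <;> fin_cases j <;> simp <;> fun_prop (disch := exact h _)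

/-! ### The quaternions of the axis rotations -/

theorem Tp_quatZ (hv : IsVParam v) (α : OnePoint ℚ_[p]) :
    Tp hv (quatZ hv α) = rotZ hv α := by
  apply SO3.mat_injective
  have e : SO3.mat (Tp hv (quatZ hv α)) =
    lambdaMatrix v * conjMatrix (quatZ hv α) * (lambdaMatrix v)⁻¹ := rfl
  have hv0 := hv.ne_zero
  rw [e, conj_explicit hv0, mat_rotZ]
  induction α using OnePoint.rec with
  | infty =>
    ext i j
    fin_cases i <;> fin_cases j <;> simp [matZ, quatZ, unitOfNrd, nrd, hv0]
  | coe a =>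
    have h := denomZ_ne_zero hv a
    ext i j
    fin_cases i <;> fin_cases j <;> simp [matZ, quatZ, unitOfNrd, nrd] <;> field_simp

theorem Tp_quatY (hv : IsVParam v) (β : OnePoint ℚ_[p]) :
    Tp hv (quatY v β) = rotY v β := by
  apply SO3.mat_injective
  have e : SO3.mat (Tp hv (quatY v β)) =
    lambdaMatrix v * conjMatrix (quatY v β) * (lambdaMatrix v)⁻¹ := rfl
  have hv0 := hv.ne_zero
  have hp0 := p_ne_zero (p := p)
  rw [e, conj_explicit hv0, mat_rotY]
  induction β using OnePoint.rec with
  | infty =>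
    ext i j
    fin_cases i <;> fin_cases j <;> simp [matY, quatY, unitOfNrd, nrd, hp0]
  | coe a =>
    have h := denomY_ne_zero a
    ext i j
    fin_cases i <;> fin_cases j <;> simp [matY, quatY, unitOfNrd, nrd] <;> field_simp

theorem Tp_quatX (hv : IsVParam v) (γ : OnePoint ℚ_[p]) :
    Tp hv (quatX hv γ) = rotX hv γ := by
  apply SO3.mat_injective
  have e : SO3.mat (Tp hv (quatX hv γ)) =
    lambdaMatrix v * conjMatrix (quatX hv γ) * (lambdaMatrix v)⁻¹ := rfl
  have hv0 := hv.ne_zero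
  have hp0 := p_ne_zero (p := p)
  rw [e, conj_explicit hv0, mat_rotX]
  induction γ using OnePoint.rec with
  | infty =>
    ext i j
    fin_cases i <;> fin_cases j <;> simp [matX, quatX, unitOfNrd, nrd] <;> field_simp
  | coe a =>
    have h := denomX_ne_zero' hv a
    ext i j
    fin_cases i <;> fin_cases j <;> simp [matX, quatX, unitOfNrd, nrd] <;> field_simp

/-! ### The decomposition of a rotation along the three axes -/

/-- The image is compact of full measure, so its complement in `ℤ_p` is an open null set, hence
empty. -/
theorem surjOn_closedBall_of_norm_sub_eq {f : ℚ_[p] → ℚ_[p]}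
    (hm : Set.MapsTo f (closedBall 0 1) (closedBall 0 1))
    (h : ∀ x ∈ closedBall (0 : ℚ_[p]) 1, ∀ y ∈ closedBall (0 : ℚ_[p]) 1,
      ‖f x - f y‖ = ‖x - y‖) : Set.SurjOn f (closedBall 0 1) (closedBall 0 1) := by
  have hc : ContinuousOn f (closedBall 0 1) :=
    (LipschitzOnWith.of_dist_le_mul (K := 1) fun x hx y hy => by
      rw [dist_eq_norm, dist_eq_norm, h x hx y hy, NNReal.coe_one, one_mul]).continuousOn
  have hK : IsCompact (f '' closedBall 0 1) := (isCompact_closedBall 0 1).image_of_continuousOn hc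
  have h1 : padicHaar p (f '' closedBall 0 1) = 1 := by
    rw [padicHaar_image (r := 1) one_ne_zero fun x hx y hy => by simp [h x hx y hy],
      padicHaar_closedBall_zero_one, ENNReal.coe_one, one_mul]
  have h2 : padicHaar p (closedBall 0 1 \ f '' closedBall 0 1) = 0 := by
    rw [measure_sdiff hm.image_subset hK.measurableSet.nullMeasurableSet (by simp [h1]), h1,
      padicHaar_closedBall_zero_one, tsub_self]
  have ho : IsOpen (closedBall (0 : ℚ_[p]) 1 \ f '' closedBall 0 1) :=
    (IsUltrametricDist.isOpen_closedBall _ one_ne_zero).sdiff hK.isClosed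
  exact Set.sdiff_eq_empty.1 (ho.eq_empty_of_measure_zero h2)

theorem norm_one_add_p_mul {t : ℚ_[p]} (ht : ‖t‖ ≤ 1) : ‖1 + p * t‖ = 1 := by
  rw [norm_add_eq_left, norm_one]
  rw [norm_mul, Padic.norm_p, norm_one]
  exact mul_lt_one_of_nonneg_of_lt_one_left (inv_nonneg.2 cast_prime_pos.le)
    (inv_lt_one_of_one_lt₀ one_lt_cast_prime) ht

theorem norm_one_sub_p_mul {t : ℚ_[p]} (ht : ‖t‖ ≤ 1) : ‖1 - p * t‖ = 1 := by
  have := norm_one_add_p_mul (t := -t) (by rwa [norm_neg])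
  rwa [mul_neg, ← sub_eq_add_neg] at this

/-- The sine of the rotation `R_y(b)`. -/
def sinY (b : ℚ_[p]) : ℚ_[p] := 2 * b / (1 + p * b ^ 2)

/-- The cosine of the rotation `R_y(b)`. -/
def cosY (b : ℚ_[p]) : ℚ_[p] := (1 - p * b ^ 2) / (1 + p * b ^ 2)

theorem cosY_sq_add (b : ℚ_[p]) : cosY b ^ 2 + p * sinY b ^ 2 = 1 := by
  have h := denomY_ne_zero b
  simp only [cosY, sinY]
  field_simp
  ring

theorem matY_coe' (b : ℚ_[p]) : matY (b : OnePoint ℚ_[p]) =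
    !![cosY b, 0, -p * sinY b; 0, 1, 0; sinY b, 0, cosY b] := by
  rw [matY_coe]
  have : -(2 * p * b) / (1 + p * b ^ 2) = -p * sinY b := by
    simp only [sinY]; ring
  rw [this]
  rfl

theorem norm_cosY {b : ℚ_[p]} (hb : ‖b‖ ≤ 1) : ‖cosY b‖ = 1 := by
  have h : ‖b ^ 2‖ ≤ 1 := by rw [norm_pow]; exact pow_le_one₀ (norm_nonneg _) hb
  rw [cosY, norm_div, norm_one_add_p_mul h, norm_one_sub_p_mul h, div_one]

theorem norm_sinY (hp : 2 < p) {b : ℚ_[p]} (hb : ‖b‖ ≤ 1) : ‖sinY b‖ = ‖b‖ := by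
  have h : ‖b ^ 2‖ ≤ 1 := by rw [norm_pow]; exact pow_le_one₀ (norm_nonneg _) hb
  rw [sinY, norm_div, norm_one_add_p_mul h, div_one, norm_mul, norm_two hp, one_mul]

/-- The difference quotient is `2` times factors congruent to one modulo `p`, and `2` is a unit. For
`cosY` the quotient carries an additional factor `p`. -/
theorem norm_sinY_sub (hp : 2 < p) {b c : ℚ_[p]} (hb : ‖b‖ ≤ 1) (hc : ‖c‖ ≤ 1) :
    ‖sinY b - sinY c‖ = ‖b - c‖ := by
  have hb2 : ‖b ^ 2‖ ≤ 1 := by rw [norm_pow]; exact pow_le_one₀ (norm_nonneg _) hb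
  have hc2 : ‖c ^ 2‖ ≤ 1 := by rw [norm_pow]; exact pow_le_one₀ (norm_nonneg _) hc
  have hbc : ‖b * c‖ ≤ 1 := by rw [norm_mul]; exact mul_le_one₀ hb (norm_nonneg _) hc
  have h : sinY b - sinY c =
      2 * (1 - p * (b * c)) / ((1 + p * b ^ 2) * (1 + p * c ^ 2)) * (b - c) := by
    have h1 := denomY_ne_zero b
    have h2 := denomY_ne_zero c
    simp only [sinY]
    rw [div_sub_div _ _ h1 h2, div_mul_eq_mul_div]
    congr 1
    ring
  rw [h, norm_mul, norm_div, norm_mul, norm_mul, norm_two hp, norm_one_add_p_mul hb2,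
    norm_one_add_p_mul hc2, norm_one_sub_p_mul hbc]
  simp

theorem norm_cosY_sub_lt {b c : ℚ_[p]} (hb : ‖b‖ ≤ 1) (hc : ‖c‖ ≤ 1) (hbc : b ≠ c) :
    ‖cosY b - cosY c‖ < ‖b - c‖ := by
  have hb2 : ‖b ^ 2‖ ≤ 1 := by rw [norm_pow]; exact pow_le_one₀ (norm_nonneg _) hb
  have hc2 : ‖c ^ 2‖ ≤ 1 := by rw [norm_pow]; exact pow_le_one₀ (norm_nonneg _) hc
  have h : cosY b - cosY c =
      p * (-2 * (b + c) / ((1 + p * b ^ 2) * (1 + p * c ^ 2))) * (b - c) := by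
    have h1 := denomY_ne_zero b
    have h2 := denomY_ne_zero c
    simp only [cosY]
    rw [div_sub_div _ _ h1 h2, mul_div_assoc', div_mul_eq_mul_div]
    congr 1
    ring
  have h3 : ‖-2 * (b + c) / ((1 + p * b ^ 2) * (1 + p * c ^ 2))‖ ≤ 1 := by
    rw [norm_div, norm_mul, norm_mul, norm_one_add_p_mul hb2, norm_one_add_p_mul hc2, mul_one,
      div_one]
    refine mul_le_one₀ ?_ (norm_nonneg _) ((Padic.nonarchimedean _ _).trans (max_le hb hc))
    simpa using Padic.norm_int_le_one (p := p) (-2)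
  have h4 : 0 < ‖b - c‖ := norm_pos_iff.2 (sub_ne_zero.2 hbc)
  rw [h, norm_mul, norm_mul, Padic.norm_p]
  refine mul_lt_of_lt_one_left h4 ?_
  exact mul_lt_one_of_nonneg_of_lt_one_left (inv_nonneg.2 cast_prime_pos.le)
    (inv_lt_one_of_one_lt₀ one_lt_cast_prime) h3

theorem exists_sinY_eq (hp : 2 < p) {z : ℚ_[p]} (hz : ‖z‖ ≤ 1) : ∃ b, ‖b‖ ≤ 1 ∧ sinY b = z := by
  obtain ⟨b, hb, h⟩ := surjOn_closedBall_of_norm_sub_eq (f := sinY (p := p))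
    (fun x hx => by
      rw [mem_closedBall, dist_zero_right] at hx ⊢
      rwa [norm_sinY hp hx])
    (fun x hx y hy => by
      rw [mem_closedBall, dist_zero_right] at hx hy
      exact norm_sinY_sub hp hx hy) (by simpa using hz : z ∈ closedBall 0 1)
  exact ⟨b, by simpa using hb, h⟩

/-- Stereographic projection from `(-1, 0)`, with slope `s = B / (1 + A)`; the centre itself
corresponds to the parameter `∞`. -/
theorem exists_conic_param {d : ℚ_[p]} (hd : d ≠ 0) {A B : ℚ_[p]} (h : A ^ 2 + d * B ^ 2 = 1) :
    (A = -1 ∧ B = 0) ∨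
      ∃ s : ℚ_[p], (1 - d * s ^ 2) / (1 + d * s ^ 2) = A ∧ 2 * s / (1 + d * s ^ 2) = B := by
  rcases eq_or_ne A (-1) with hA | hA
  · left
    refine ⟨hA, ?_⟩
    rw [hA] at h
    have : d * B ^ 2 = 0 := by linear_combination h
    simpa [hd] using this
  · right
    have hA' : 1 + A ≠ 0 := fun h0 => hA (by linear_combination h0)
    have hD : 1 + d * (B / (1 + A)) ^ 2 = 2 / (1 + A) := by
      rw [div_pow, mul_div_assoc', add_div' _ _ _ (pow_ne_zero 2 hA'),
        div_eq_div_iff (pow_ne_zero 2 hA') hA']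
      linear_combination (1 + A) * h
    refine ⟨B / (1 + A), ?_, ?_⟩
    · rw [show 1 - d * (B / (1 + A)) ^ 2 = 2 - (1 + d * (B / (1 + A)) ^ 2) by ring, hD]
      field_simp
      ring
    · rw [hD]
      field_simp

theorem exists_matZ_eq_of_conic (hv0 : v ≠ 0) {A B : ℚ_[p]} (h : A ^ 2 - v * B ^ 2 = 1) :
    ∃ α, matZ v α = !![A, v * B, 0; B, A, 0; 0, 0, 1] := by
  rcases exists_conic_param (d := -v) (A := A) (B := B) (by simpa using hv0)
    (by linear_combination h) with ⟨rfl, rfl⟩ | ⟨s, rfl, rfl⟩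
  · exact ⟨OnePoint.infty, by simp [matZ_infty]⟩
  · refine ⟨s, ?_⟩
    rw [matZ_coe]
    simp only [neg_mul, sub_neg_eq_add, ← sub_eq_add_neg]
    rw [mul_div_assoc', mul_assoc, mul_left_comm]

theorem exists_matZ_eq (hv : IsVParam v) (α : OnePoint ℚ_[p]) :
    ∃ A B : ℚ_[p], A ^ 2 - v * B ^ 2 = 1 ∧ matZ v α = !![A, v * B, 0; B, A, 0; 0, 0, 1] := by
  induction α using OnePoint.rec with
  | infty => exact ⟨-1, 0, by ring, by simp [matZ_infty]⟩
  | coe a =>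
    refine ⟨(1 + v * a ^ 2) / (1 - v * a ^ 2), 2 * a / (1 - v * a ^ 2), ?_, ?_⟩
    · have := denomZ_ne_zero hv a
      field_simp
      ring
    · rw [matZ_coe, mul_div_assoc', mul_left_comm, mul_assoc]

theorem exists_matX_eq_of_conic (hv0 : v ≠ 0) {A B : ℚ_[p]}
    (h : A ^ 2 - (p : ℚ_[p]) / v * B ^ 2 = 1) :
    ∃ γ, matX v γ = !![1, 0, 0; 0, A, (p : ℚ_[p]) / v * B; 0, B, A] := by
  have hp0 := p_ne_zero (p := p)
  rcases exists_conic_param (d := -((p : ℚ_[p]) / v)) (A := A) (B := B)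
    (neg_ne_zero.2 (div_ne_zero hp0 hv0)) (by linear_combination h) with ⟨rfl, rfl⟩ | ⟨s, rfl, rfl⟩
  · exact ⟨OnePoint.infty, by simp [matX_infty]⟩
  · refine ⟨s, ?_⟩
    rw [matX_coe]
    simp only [neg_mul, sub_neg_eq_add, ← sub_eq_add_neg]
    rw [mul_div_assoc' (p / v), mul_left_comm, ← mul_assoc 2]

theorem rotZ_mul_comm (hv : IsVParam v) (α β : OnePoint ℚ_[p]) :
    rotZ hv α * rotZ hv β = rotZ hv β * rotZ hv α := by
  obtain ⟨A, B, -, h1⟩ := exists_matZ_eq hv α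
  obtain ⟨C, D, -, h2⟩ := exists_matZ_eq hv β
  apply SO3.mat_injective
  simp only [SO3.mat_mul, mat_rotZ, h1, h2]
  ext i j
  fin_cases i <;> fin_cases j <;> simp [Matrix.mul_apply, Fin.sum_univ_three] <;> ring

theorem norm_sq_sub_mul_sq (hp : 2 < p) (hv : IsNonquadraticUnit v) (x y : ℚ_[p]) :
    ‖x ^ 2 - v * y ^ 2‖ = max ‖x‖ ‖y‖ ^ 2 := by
  rcases le_or_gt ‖y‖ ‖x‖ with h | h
  · rw [max_eq_left h]
    rcases eq_or_ne x 0 with rfl | hx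
    · have : y = 0 := by simpa using h
      simp [this]
    · have e : x ^ 2 - v * y ^ 2 = x ^ 2 * (1 + -v * (y / x) ^ 2) := by
        field_simp
        ring
      rw [e, norm_mul, (hv.isAxisParam_neg hp).norm_of_le, mul_one, norm_pow]
      rw [norm_div]
      exact div_le_one_of_le₀ h (norm_nonneg _)
  · rw [max_eq_right h.le, ← norm_neg, neg_sub, sub_eq_add_neg, norm_add_eq_left, norm_mul, hv.1,
      one_mul, norm_pow]
    rw [norm_neg, norm_mul, hv.1, one_mul, norm_pow, norm_pow]
    exact pow_lt_pow_left₀ h (norm_nonneg _) two_ne_zero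

theorem norm_sq_ne_inv (t : ℚ_[p]) : ‖t‖ ^ 2 ≠ (p : ℝ)⁻¹ := by
  intro h
  have hp1 := one_lt_cast_prime (p := p)
  have hp0 := cast_prime_pos (p := p)
  have hi1 := inv_lt_one_of_one_lt₀ hp1
  have hi0 := inv_pos.2 hp0
  have h1 : ‖t‖ < 1 := by nlinarith [norm_nonneg t]
  have h2 : ‖t‖ ≤ (p : ℝ)⁻¹ := by
    have := le_zpow_of_lt_zpow_succ (x := t) (n := -1) (by simpa using h1)
    simpa using this
  nlinarith [norm_nonneg t]

/-- The valuation of `x² - v y²` is even, as `v` is a nonsquare unit, and that of `p z²` is odd, so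
the two cannot cancel. If `|z| > 1`, then already `|p z²| > 1`, which is impossible. -/
theorem max_norm_eq_one_of_form_eq_one (hp : 2 < p) (hv : IsNonquadraticUnit v) {x y z : ℚ_[p]}
    (h : x ^ 2 - v * y ^ 2 + p * z ^ 2 = 1) : max ‖x‖ ‖y‖ = 1 ∧ ‖z‖ ≤ 1 := by
  have hN := norm_sq_sub_mul_sq hp hv x y
  have hz : ‖z‖ ≤ 1 := by
    by_contra! hz
    have hp1 := one_lt_cast_prime (p := p)
    have hpz := cast_prime_le_of_one_lt_norm hz
    have h1 : ‖(p : ℚ_[p]) * z ^ 2‖ = (p : ℝ)⁻¹ * ‖z‖ ^ 2 := by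
      rw [norm_mul, Padic.norm_p, norm_pow]
    have h2 : 1 < ‖(p : ℚ_[p]) * z ^ 2‖ := by
      rw [h1, inv_mul_eq_div, one_lt_div cast_prime_pos]
      nlinarith
    have hne : ‖x ^ 2 - v * y ^ 2‖ ≠ ‖(p : ℚ_[p]) * z ^ 2‖ := by
      rw [hN, h1]
      obtain ⟨w, hw⟩ : ∃ w : ℚ_[p], max ‖x‖ ‖y‖ = ‖w‖ := by
        rcases max_choice ‖x‖ ‖y‖ with h | h
        exacts [⟨x, h⟩, ⟨y, h⟩]
      rw [hw]
      intro he
      apply norm_sq_ne_inv (w / z)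
      rw [norm_div, div_pow, he, mul_div_assoc, div_self (by positivity), mul_one]
    have h3 := Padic.add_eq_max_of_ne hne
    rw [h, norm_one] at h3
    exact (h2.trans_le (le_max_right ‖x ^ 2 - v * y ^ 2‖ _)).ne h3
  refine ⟨?_, hz⟩
  have h1 : ‖z ^ 2‖ ≤ 1 := by rw [norm_pow]; exact pow_le_one₀ (norm_nonneg _) hz
  rw [show x ^ 2 - v * y ^ 2 = 1 - p * z ^ 2 by linear_combination h, norm_one_sub_p_mul h1] at hN
  exact (pow_eq_one_iff_of_nonneg (le_max_of_le_left (norm_nonneg _)) two_ne_zero).1 hN.symm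

theorem SO3.column_zero (R : SO3 v) :
    SO3.mat R 0 0 ^ 2 - v * SO3.mat R 1 0 ^ 2 + p * SO3.mat R 2 0 ^ 2 = 1 := by
  have h := congrFun (congrFun (SO3.transpose_mul_form_mul R) 0) 0
  simp [formMatrix, Matrix.mul_apply, Fin.sum_univ_three, Matrix.diagonal] at h
  linear_combination h

theorem exists_eq_rotX (hv : IsVParam v) {S : SO3 v} (h0 : SO3.mat S 0 0 = 1)
    (h1 : SO3.mat S 1 0 = 0) (h2 : SO3.mat S 2 0 = 0) : ∃ γ, S = rotX hv γ := by
  have hv0 := hv.ne_zero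
  have hform := SO3.transpose_mul_form_mul S
  have e := fun i j => congrFun (congrFun hform i) j
  simp [formMatrix, Matrix.mul_apply, Fin.sum_univ_three, Matrix.diagonal] at e
  have e01 := e 0 1
  have e02 := e 0 2
  have e11 := e 1 1
  have e12 := e 1 2
  have hdet := SO3.det_mat S
  rw [Matrix.det_fin_three] at hdet
  simp [h0, h1, h2] at e01 e02 e11 e12 hdet
  simp only [e01, e02] at e11 e12 hdet
  set s := SO3.mat S 1 1
  set t := SO3.mat S 1 2
  set u := SO3.mat S 2 1
  set w := SO3.mat S 2 2
  -- The inverse of the remaining `2 × 2` block is both its adjugate and its adjoint for the form;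
  -- comparing the two gives this and the next relation.
  have hsw : s = w := mul_left_cancel₀ hv0 (by
    linear_combination (-w) * e11 + u * e12 - v * s * hdet)
  have htu : t = p / v * u := by
    rw [div_mul_eq_mul_div, eq_div_iff hv0]
    linear_combination t * e11 - s * e12 + p * u * hdet
  have hcon : s ^ 2 - p / v * u ^ 2 = 1 := by
    rw [← hsw, htu] at hdet
    linear_combination hdet
  obtain ⟨γ, hγ⟩ := exists_matX_eq_of_conic hv0 hcon
  refine ⟨γ, SO3.mat_injective ?_⟩
  rw [mat_rotX, hγ]
  ext i j
  fin_cases i <;> fin_cases j <;> simp [h0, h1, h2, e01, e02] <;>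
    first | rfl | exact htu | exact hsw.symm

/-- The first column `(x, y, z)` decides. Take `b` with `sinY b = z`; then `x² - v y² = 1 - p z² =
(cosY b)²` with `cosY b` a unit, so `(x, y) / cosY b` lies on the conic of the rotations about `z`
and yields `α`. What remains fixes the first basis vector, so it is a rotation about `x`. -/
theorem exists_decomposition (hp : 2 < p) (hv : IsVParam v) (R : SO3 v) :
    ∃ (α : OnePoint ℚ_[p]) (b : ℚ_[p]) (γ : OnePoint ℚ_[p]), ‖b‖ ≤ 1 ∧ sinY b = SO3.mat R 2 0 ∧
      R = rotZ hv α * rotY v b * rotX hv γ := by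
  have hcol := SO3.column_zero R
  obtain ⟨-, hz⟩ := max_norm_eq_one_of_form_eq_one hp hv.nonquadratic hcol
  obtain ⟨b, hb, hbz⟩ := exists_sinY_eq hp hz
  have hc0 : cosY b ≠ 0 := norm_ne_zero_iff.1 (by rw [norm_cosY hb]; exact one_ne_zero)
  have hcs := cosY_sq_add b
  rw [← hbz] at hcol
  obtain ⟨α, hα⟩ := exists_matZ_eq_of_conic hv.ne_zero
    (A := SO3.mat R 0 0 / cosY b) (B := SO3.mat R 1 0 / cosY b) (by
      field_simp
      linear_combination hcol - hcs)
  have hS : SO3.mat ((rotZ hv α * rotY v b)⁻¹ * R) *ᵥ (Pi.single 0 1) = Pi.single 0 1 := by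
    have h1 : SO3.mat R *ᵥ Pi.single 0 1 = SO3.mat (rotZ hv α * rotY v b) *ᵥ Pi.single 0 1 := by
      rw [SO3.mat_mul, mat_rotZ, mat_rotY, hα, matY_coe']
      ext i
      fin_cases i <;> simp [hbz] <;> field_simp
    rw [SO3.mat_mul, ← Matrix.mulVec_mulVec, h1, Matrix.mulVec_mulVec, ← SO3.mat_mul,
      inv_mul_cancel, SO3.mat_one, Matrix.one_mulVec]
  have hent : ∀ i, SO3.mat ((rotZ hv α * rotY v b)⁻¹ * R) i 0 =
      Pi.single (M := fun _ => ℚ_[p]) 0 1 i := by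
    intro i
    rw [← hS]
    simp
  obtain ⟨γ, hγ⟩ := exists_eq_rotX hv ((hent 0).trans (by simp)) ((hent 1).trans (by simp))
    ((hent 2).trans (by simp))
  exact ⟨α, b, γ, hb, hbz, by rw [← hγ, mul_inv_cancel_left]⟩

/-! ### Weighted integrals on the projective line -/

theorem integral_axisMeasure {d : ℚ_[p]} (f : ℚ_[p] → ℂ) :
    ∫ x, f x ∂(axisMeasure d) = ∫ x, f x * ((1 / ‖1 + d * x ^ 2‖ : ℝ) : ℂ) ∂(padicHaar p) := by
  rw [axisMeasure, integral_withDensity_eq_integral_smul (measurable_axisDensity d)]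
  refine integral_congr_ae (Eventually.of_forall fun x => ?_)
  simp only [NNReal.smul_def, NNReal.coe_div, NNReal.coe_one, coe_nnnorm, Complex.real_smul]
  rw [mul_comm]

theorem integrable_axisMeasure_iff {d : ℚ_[p]} (f : ℚ_[p] → ℂ) :
    Integrable f (axisMeasure d) ↔
      Integrable (fun x => f x * ((1 / ‖1 + d * x ^ 2‖ : ℝ) : ℂ)) (padicHaar p) := by
  rw [axisMeasure, integrable_withDensity_iff_integrable_smul (measurable_axisDensity d)]
  refine integrable_congr (Eventually.of_forall fun x => ?_)
  simp only [NNReal.smul_def, NNReal.coe_div, NNReal.coe_one, coe_nnnorm, Complex.real_smul]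
  rw [mul_comm]

theorem measurableEmbedding_onePoint_coe :
    MeasurableEmbedding fun x : ℚ_[p] => (x : OnePoint ℚ_[p]) :=
  OnePoint.isOpenEmbedding_coe.measurableEmbedding

theorem integral_mul_weight_lineHaar (d : ℚ_[p]) (F : OnePoint ℚ_[p] → ℂ) :
    ∫ α, F α * (weight d α : ℂ) ∂(lineHaar p) = ∫ x : ℚ_[p], F x ∂(axisMeasure d) := by
  rw [lineHaar, measurableEmbedding_onePoint_coe.integral_map, integral_axisMeasure]
  rfl

theorem integrable_mul_weight_lineHaar_iff (d : ℚ_[p]) (F : OnePoint ℚ_[p] → ℂ) :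
    Integrable (fun α => F α * (weight d α : ℂ)) (lineHaar p) ↔
      Integrable (fun x : ℚ_[p] => F x) (axisMeasure d) := by
  rw [lineHaar, measurableEmbedding_onePoint_coe.integrable_map_iff, integrable_axisMeasure_iff]
  rfl

/-! ### Rotations about `z` and `x`: averaging with the invariant measure -/

/-- Left multiplication by `g` acts on the family `ρ` through a `W`-preserving change of the
parameter. -/
def ActsBy {G Ω : Type*} [Mul G] [MeasurableSpace Ω] (W : Measure Ω) (ρ : Ω → G) (g : G) : Prop :=
  ∃ T : Ω → Ω, MeasurePreserving T W W ∧ ∀ᵐ s ∂W, g * ρ s = ρ (T s)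

theorem ActsBy.mul {G Ω : Type*} [Semigroup G] [MeasurableSpace Ω] {W : Measure Ω} {ρ : Ω → G}
    {g h : G} (hg : ActsBy W ρ g) (hh : ActsBy W ρ h) : ActsBy W ρ (g * h) := by
  obtain ⟨T, hT, hTe⟩ := hg
  obtain ⟨U, hU, hUe⟩ := hh
  refine ⟨T ∘ U, hT.comp hU, ?_⟩
  filter_upwards [hUe, hU.quasiMeasurePreserving.ae hTe] with s h1 h2
  rw [mul_assoc, h1, h2, Function.comp]

/-- Each fibre is `g` up to a measure-preserving reparametrisation, so all fibre averages agree.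
Both directions are required because `g` is not known to be measurable: `τ'` transfers integrability
from one good fibre to `g`, after which `τ` evaluates every fibre integral. -/
theorem integral_eq_of_fibers {G Ω : Type*} [MeasurableSpace G] [MeasurableSpace Ω]
    {μ : Measure G} [IsProbabilityMeasure μ] {W : Measure Ω} [IsFiniteMeasure W]
    (hW : W Set.univ ≠ 0) {T : G × Ω → G}
    (hT : MeasurePreserving T (μ.prod ((W Set.univ)⁻¹ • W)) μ) {ψ : G → ℂ} (hψ : Integrable ψ μ)
    {g : Ω → ℂ} (hfib : ∀ R, ∃ τ τ' : Ω → Ω, MeasurePreserving τ W W ∧ MeasurePreserving τ' W W ∧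
      (∀ᵐ s ∂W, ψ (T (R, s)) = g (τ s)) ∧ ∀ᵐ s ∂W, g s = ψ (T (R, τ' s))) :
    Integrable g W ∧ ∫ R, ψ R ∂μ = ((W Set.univ).toReal : ℂ)⁻¹ * ∫ s, g s ∂W := by
  have hWinv : (W Set.univ)⁻¹ ≠ 0 := ENNReal.inv_ne_zero.2 (measure_ne_top W _)
  have hWinv' : (W Set.univ)⁻¹ ≠ ⊤ := ENNReal.inv_ne_top.2 hW
  obtain ⟨hi, he⟩ := integral_eq_integral_integral_of_measurePreserving hT hψ
  have hμ : μ ≠ 0 := IsProbabilityMeasure.ne_zero μ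
  have : (ae μ).NeBot := ae_neBot.2 hμ
  have hg : Integrable g W := by
    obtain ⟨R, hR⟩ := hi.exists
    obtain ⟨τ, τ', -, hτ', -, h'⟩ := hfib R
    rw [integrable_smul_measure hWinv hWinv'] at hR
    exact (hτ'.integrable_comp_of_integrable hR).congr (h'.mono fun s hs => hs.symm)
  refine ⟨hg, ?_⟩
  have hinner : ∀ R, ∫ s, ψ (T (R, s)) ∂((W Set.univ)⁻¹ • W) =
      ((W Set.univ).toReal : ℂ)⁻¹ * ∫ s, g s ∂W := by
    intro R
    obtain ⟨τ, τ', hτ, -, h, -⟩ := hfib R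
    rw [integral_smul_measure, integral_congr_ae h, ENNReal.toReal_inv, Complex.real_smul,
      Complex.ofReal_inv]
    congr 1
    have hgm : AEStronglyMeasurable g (W.map τ) := by rw [hτ.map_eq]; exact hg.1
    conv_rhs => rw [← hτ.map_eq]
    rw [integral_map hτ.measurable.aemeasurable hgm]
  rw [he]
  simp [hinner]

theorem isProbabilityMeasure_inv_smul {Ω : Type*} [MeasurableSpace Ω] {W : Measure Ω}
    [IsFiniteMeasure W] (hW : W Set.univ ≠ 0) : IsProbabilityMeasure ((W Set.univ)⁻¹ • W) :=
  ⟨by simp [ENNReal.inv_mul_cancel hW (measure_ne_top W _)]⟩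

theorem conic_param_add {d : ℚ_[p]} (hd : IsAxisParam d) {a x : ℚ_[p]} (h : 1 - d * a * x ≠ 0) :
    (1 - d * ((x + a) / (1 - d * a * x)) ^ 2) / (1 + d * ((x + a) / (1 - d * a * x)) ^ 2) =
      ((1 - d * a ^ 2) / (1 + d * a ^ 2)) * ((1 - d * x ^ 2) / (1 + d * x ^ 2)) -
        d * ((2 * a / (1 + d * a ^ 2)) * (2 * x / (1 + d * x ^ 2))) ∧
    2 * ((x + a) / (1 - d * a * x)) / (1 + d * ((x + a) / (1 - d * a * x)) ^ 2) =
      (2 * a / (1 + d * a ^ 2)) * ((1 - d * x ^ 2) / (1 + d * x ^ 2)) +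
        ((1 - d * a ^ 2) / (1 + d * a ^ 2)) * (2 * x / (1 + d * x ^ 2)) := by
  have h1 := hd.denom_ne_zero a
  have h2 := hd.denom_ne_zero x
  have e : 1 + d * ((x + a) / (1 - d * a * x)) ^ 2 =
      (1 + d * a ^ 2) * (1 + d * x ^ 2) / (1 - d * a * x) ^ 2 := by
    rw [div_pow, mul_div_assoc', add_div' _ _ _ (pow_ne_zero 2 h)]
    congr 1
    ring
  have e' : 1 - d * ((x + a) / (1 - d * a * x)) ^ 2 =
      ((1 - d * a * x) ^ 2 - d * (x + a) ^ 2) / (1 - d * a * x) ^ 2 := by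
    rw [div_pow, mul_div_assoc', sub_div' (pow_ne_zero 2 h), one_mul]
  constructor
  · rw [e', e, div_div_div_cancel_right₀ (pow_ne_zero 2 h), div_mul_div_comm, div_mul_div_comm,
      mul_div_assoc', ← sub_div]
    congr 1
    ring
  · rw [e, div_div_eq_mul_div, div_mul_div_comm, div_mul_div_comm, ← add_div]
    congr 1
    rw [mul_assoc, sq (1 - d * a * x), ← mul_assoc ((x + a) / _), div_mul_cancel₀ _ h]
    ring

theorem ae_axisMeasure_denom_ne_zero (d a : ℚ_[p]) :
    ∀ᵐ x ∂(axisMeasure d), 1 - d * a * x ≠ 0 := by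
  refine (withDensity_absolutelyContinuous _ _).ae_le ?_
  change ∀ᵐ x ∂(padicHaar p), 1 - d * a * x ≠ 0
  rw [ae_iff]
  refine measure_mono_null (fun x hx => ?_)
    (padicHaar_setOf_linear_eq_zero (c := -(d * a)) (Or.inr one_ne_zero))
  simp only [Set.mem_ofPred_eq, not_not] at hx ⊢
  linear_combination hx

theorem matZ_coe' (a : ℚ_[p]) : matZ v (a : OnePoint ℚ_[p]) =
    !![(1 - -v * a ^ 2) / (1 + -v * a ^ 2), v * (2 * a / (1 + -v * a ^ 2)), 0;
       2 * a / (1 + -v * a ^ 2), (1 - -v * a ^ 2) / (1 + -v * a ^ 2), 0;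
       0, 0, 1] := by
  rw [matZ_coe]
  simp only [neg_mul, sub_neg_eq_add, ← sub_eq_add_neg]
  rw [mul_div_assoc' v, mul_left_comm, ← mul_assoc 2]

theorem matX_coe' (c : ℚ_[p]) : matX v (c : OnePoint ℚ_[p]) =
    !![1, 0, 0;
       0, (1 - -((p : ℚ_[p]) / v) * c ^ 2) / (1 + -((p : ℚ_[p]) / v) * c ^ 2),
         (p : ℚ_[p]) / v * (2 * c / (1 + -((p : ℚ_[p]) / v) * c ^ 2));
       0, 2 * c / (1 + -((p : ℚ_[p]) / v) * c ^ 2),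
         (1 - -((p : ℚ_[p]) / v) * c ^ 2) / (1 + -((p : ℚ_[p]) / v) * c ^ 2)] := by
  rw [matX_coe]
  simp only [neg_mul, sub_neg_eq_add, ← sub_eq_add_neg]
  rw [mul_div_assoc' ((p : ℚ_[p]) / v), mul_left_comm, ← mul_assoc 2]

theorem IsVParam.norm_p_div (hv : IsVParam v) : ‖-((p : ℚ_[p]) / v)‖ = (p : ℝ)⁻¹ := by
  rw [norm_neg, norm_div, hv.nonquadratic.1, div_one, Padic.norm_p]

theorem conic_param_neg_inv {w : ℚ_[p]} (h0 : w ≠ 0) :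
    (1 + w * (-w⁻¹) ^ 2) / (1 - w * (-w⁻¹) ^ 2) = -((1 + w) / (1 - w)) ∧
      2 * -w⁻¹ / (1 - w * (-w⁻¹) ^ 2) = 2 / (1 - w) ∧
      2 * w * -w⁻¹ / (1 - w * (-w⁻¹) ^ 2) = w * (2 / (1 - w)) := by
  have e1 : (1 + w * (-w⁻¹) ^ 2) / (1 - w * (-w⁻¹) ^ 2) = -((1 + w) / (1 - w)) := by
    rw [show 1 + w * (-w⁻¹) ^ 2 = (1 + w) / w by field_simp; ring,
      show 1 - w * (-w⁻¹) ^ 2 = -(1 - w) / w by field_simp; ring, div_div_div_cancel_right₀ h0,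
      div_neg]
  have e2 : 2 * -w⁻¹ / (1 - w * (-w⁻¹) ^ 2) = 2 / (1 - w) := by
    rw [show 1 - w * (-w⁻¹) ^ 2 = -(1 - w) / w by field_simp; ring, div_div_eq_mul_div,
      div_neg, ← neg_div]
    congr 1
    field_simp
  exact ⟨e1, e2, by rw [← e2]; ring⟩

/-- The parameter `-1/v` is the one whose composition with `1` has vanishing denominator. The
factorisation reduces the action of the half turn to finite parameters. -/
theorem rotZ_infty_eq (hv : IsVParam v) :
    rotZ hv OnePoint.infty = rotZ hv ((1 : ℚ_[p]) : OnePoint ℚ_[p]) *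
      rotZ hv ((-v⁻¹ : ℚ_[p]) : OnePoint ℚ_[p]) := by
  apply SO3.mat_injective
  have h1 : 1 - v ≠ 0 := by simpa using denomZ_ne_zero hv 1
  obtain ⟨e1, e2, e3⟩ := conic_param_neg_inv hv.ne_zero
  rw [SO3.mat_mul, mat_rotZ, mat_rotZ, mat_rotZ, matZ_infty, matZ_coe, matZ_coe, e1, e2, e3]
  ext i j
  fin_cases i <;> fin_cases j <;> simp [Matrix.mul_apply, Fin.sum_univ_three] <;>
    field_simp <;> ring

theorem rotX_infty_eq (hv : IsVParam v) :
    rotX hv OnePoint.infty = rotX hv ((1 : ℚ_[p]) : OnePoint ℚ_[p]) *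
      rotX hv ((-((p : ℚ_[p]) / v)⁻¹ : ℚ_[p]) : OnePoint ℚ_[p]) := by
  apply SO3.mat_injective
  have h0 : (p : ℚ_[p]) / v ≠ 0 := div_ne_zero p_ne_zero hv.ne_zero
  have h1 : 1 - (p : ℚ_[p]) / v ≠ 0 := by simpa using denomX_ne_zero hv 1
  obtain ⟨e1, e2, e3⟩ := conic_param_neg_inv h0
  rw [SO3.mat_mul, mat_rotX, mat_rotX, mat_rotX, matX_infty, matX_coe, matX_coe, e1, e2, e3]
  generalize (p : ℚ_[p]) / v = w at *
  ext i j
  fin_cases i <;> fin_cases j <;> simp [Matrix.mul_apply, Fin.sum_univ_three] <;>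
    field_simp <;> ring

theorem actsBy_rotZ (hp : 2 < p) (hv : IsVParam v) (α : OnePoint ℚ_[p]) :
    ActsBy (axisMeasure (-v)) (fun a : ℚ_[p] => rotZ hv (a : OnePoint ℚ_[p])) (rotZ hv α) := by
  have hd := hv.nonquadratic.isAxisParam_neg hp
  have hfin : ∀ a : ℚ_[p], ActsBy (axisMeasure (-v))
      (fun a : ℚ_[p] => rotZ hv (a : OnePoint ℚ_[p])) (rotZ hv a) := by
    intro a
    refine ⟨_, measurePreserving_axisMeasure hd a, ?_⟩
    filter_upwards [ae_axisMeasure_denom_ne_zero (-v) a] with x hx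
    obtain ⟨h1, h2⟩ := conic_param_add hd hx
    apply SO3.mat_injective
    rw [SO3.mat_mul, mat_rotZ, mat_rotZ, mat_rotZ, matZ_coe', matZ_coe', matZ_coe', h1, h2]
    ext i j
    fin_cases i <;> fin_cases j <;> simp [Matrix.mul_apply, Fin.sum_univ_three] <;> ring
  induction α using OnePoint.rec with
  | infty => rw [rotZ_infty_eq]; exact (hfin _).mul (hfin _)
  | coe a => exact hfin a

theorem actsBy_rotX (hv : IsVParam v) (γ : OnePoint ℚ_[p]) :
    ActsBy (axisMeasure (-((p : ℚ_[p]) / v))) (fun c : ℚ_[p] => rotX hv (c : OnePoint ℚ_[p]))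
      (rotX hv γ) := by
  have hd := isAxisParam_of_norm_eq_inv hv.norm_p_div
  have hfin : ∀ a : ℚ_[p], ActsBy (axisMeasure (-((p : ℚ_[p]) / v)))
      (fun a : ℚ_[p] => rotX hv (a : OnePoint ℚ_[p])) (rotX hv a) := by
    intro a
    refine ⟨_, measurePreserving_axisMeasure hd a, ?_⟩
    filter_upwards [ae_axisMeasure_denom_ne_zero (-((p : ℚ_[p]) / v)) a] with x hx
    obtain ⟨h1, h2⟩ := conic_param_add hd hx
    apply SO3.mat_injective
    rw [SO3.mat_mul, mat_rotX, mat_rotX, mat_rotX, matX_coe', matX_coe', matX_coe', h1, h2]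
    ext i j
    fin_cases i <;> fin_cases j <;> simp [Matrix.mul_apply, Fin.sum_univ_three] <;> ring
  induction γ using OnePoint.rec with
  | infty => rw [rotX_infty_eq]; exact (hfin _).mul (hfin _)
  | coe a => exact hfin a

theorem exists_rotZ_inv (hv : IsVParam v) (α : OnePoint ℚ_[p]) :
    ∃ α', (rotZ hv α)⁻¹ = rotZ hv α' := by
  obtain ⟨A, B, h, hm⟩ := exists_matZ_eq hv α
  obtain ⟨α', hm'⟩ := exists_matZ_eq_of_conic hv.ne_zero (A := A) (B := -B) (by rw [neg_sq, h])
  refine ⟨α', inv_eq_of_mul_eq_one_right (SO3.mat_injective ?_)⟩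
  rw [SO3.mat_mul, mat_rotZ, mat_rotZ, hm, hm', SO3.mat_one]
  ext i j
  fin_cases i <;> fin_cases j <;> simp [Matrix.mul_apply, Fin.sum_univ_three] <;>
    first | ring1 | linear_combination h

theorem exists_rotZ_mul (hv : IsVParam v) (α β : OnePoint ℚ_[p]) :
    ∃ δ, rotZ hv α * rotZ hv β = rotZ hv δ := by
  obtain ⟨A, B, h, hm⟩ := exists_matZ_eq hv α
  obtain ⟨C, D, h', hm'⟩ := exists_matZ_eq hv β
  obtain ⟨δ, hδ⟩ := exists_matZ_eq_of_conic hv.ne_zero (A := A * C + v * B * D)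
    (B := A * D + B * C) (by linear_combination (C ^ 2 - v * D ^ 2) * h + h')
  refine ⟨δ, SO3.mat_injective ?_⟩
  rw [SO3.mat_mul, mat_rotZ, mat_rotZ, mat_rotZ, hm, hm', hδ]
  ext i j
  fin_cases i <;> fin_cases j <;> simp [Matrix.mul_apply, Fin.sum_univ_three] <;> ring

theorem exists_rotX_inv (hv : IsVParam v) (γ : OnePoint ℚ_[p]) :
    ∃ γ', (rotX hv γ)⁻¹ = rotX hv γ' := by
  obtain ⟨A, B, h, hm⟩ : ∃ A B : ℚ_[p], A ^ 2 - (p : ℚ_[p]) / v * B ^ 2 = 1 ∧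
      matX v γ = !![1, 0, 0; 0, A, (p : ℚ_[p]) / v * B; 0, B, A] := by
    induction γ using OnePoint.rec with
    | infty => exact ⟨-1, 0, by ring, by simp [matX_infty]⟩
    | coe c =>
      refine ⟨_, _, ?_, matX_coe' c⟩
      have := (isAxisParam_of_norm_eq_inv hv.norm_p_div).denom_ne_zero c
      generalize (p : ℚ_[p]) / v = w at *
      rw [div_pow, div_pow, mul_div_assoc', ← sub_div, div_eq_one_iff_eq (pow_ne_zero 2 this)]
      ring
  obtain ⟨γ', hm'⟩ := exists_matX_eq_of_conic hv.ne_zero (A := A) (B := -B) (by rw [neg_sq, h])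
  refine ⟨γ', inv_eq_of_mul_eq_one_right (SO3.mat_injective ?_)⟩
  rw [SO3.mat_mul, mat_rotX, mat_rotX, hm, hm', SO3.mat_one]
  ext i j
  fin_cases i <;> fin_cases j <;> simp [Matrix.mul_apply, Fin.sum_univ_three] <;>
    first | ring1 | linear_combination h

instance (μ : Measure (SO3 v)) [μ.IsHaarMeasure] [IsProbabilityMeasure μ] :
    μ.IsMulRightInvariant := isMulRightInvariant_of_isProbabilityMeasure μ

theorem integral_eq_of_invariant_rotZ (hp : 2 < p) (hv : IsVParam v) (μ : Measure (SO3 v))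
    [μ.IsHaarMeasure] [IsProbabilityMeasure μ] {φ : SO3 v → ℂ} (hφ : Integrable φ μ)
    (h : ∀ α β γ : OnePoint ℚ_[p], φ (rotZ hv α * rotY v β * rotX hv γ) = φ (rotZ hv α)) :
    Integrable (fun a : ℚ_[p] => φ (rotZ hv a)) (axisMeasure (-v)) ∧
      ∫ R, φ R ∂μ = (1 + 1 / (p : ℂ))⁻¹ * ∫ a : ℚ_[p], φ (rotZ hv a) ∂(axisMeasure (-v)) := by
  have hmass := axisMeasure_univ_of_norm_eq_one (hv.nonquadratic.isAxisParam_neg hp)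
    (by rw [norm_neg, hv.nonquadratic.1])
  have hpos : (0 : ℝ) < 1 + 1 / p := by positivity
  have hW : axisMeasure (-v) Set.univ ≠ 0 := by rw [hmass]; simpa using hpos
  have : IsFiniteMeasure (axisMeasure (-v)) := ⟨by rw [hmass]; exact ENNReal.ofReal_lt_top⟩
  have := isProbabilityMeasure_inv_smul hW
  have key := integral_eq_of_fibers hW
    (measurePreserving_mul_prod μ ((axisMeasure (-v) Set.univ)⁻¹ • axisMeasure (-v))
      (continuous_rotZ_coe hv).measurable) hφ (g := fun a : ℚ_[p] => φ (rotZ hv a)) ?_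
  · rwa [hmass, ENNReal.toReal_ofReal hpos.le, show ((1 + 1 / (p : ℝ) : ℝ) : ℂ) = 1 + 1 / (p : ℂ) by
      push_cast; rfl] at key
  · intro R
    obtain ⟨α, b, γ, -, -, rfl⟩ := exists_decomposition hp hv R
    -- Rotations about `z` commute, so `R_z(s) R` has first factor `R_z(α) R_z(s) = R_z(T s)`. The
    -- inverse rotation provides the reverse reparametrisation.
    obtain ⟨T, hT, hTe⟩ := actsBy_rotZ hp hv α
    obtain ⟨α', hα'⟩ := exists_rotZ_inv hv α
    obtain ⟨U, hU, hUe⟩ := actsBy_rotZ hp hv α'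
    refine ⟨T, U, hT, hU, hTe.mono fun s hs => ?_, hUe.mono fun s hs => ?_⟩
    · simp only
      rw [← mul_assoc, ← mul_assoc, rotZ_mul_comm, hs, h]
    · have hs' : rotZ hv s = rotZ hv (U s : ℚ_[p]) * rotZ hv α := by
        rw [rotZ_mul_comm, ← inv_mul_eq_iff_eq_mul, hα']
        exact hs
      simp only
      rw [← mul_assoc, ← mul_assoc, ← hs', h]

theorem integral_eq_of_invariant_rotX (hp : 2 < p) (hv : IsVParam v) (μ : Measure (SO3 v))
    [μ.IsHaarMeasure] [IsProbabilityMeasure μ] {φ : SO3 v → ℂ} (hφ : Integrable φ μ)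
    (h : ∀ α β γ : OnePoint ℚ_[p], φ (rotZ hv α * rotY v β * rotX hv γ) = φ (rotX hv γ)) :
    Integrable (fun c : ℚ_[p] => φ (rotX hv c)) (axisMeasure (-((p : ℚ_[p]) / v))) ∧
      ∫ R, φ R ∂μ = 1 / 2 * ∫ c : ℚ_[p], φ (rotX hv c) ∂(axisMeasure (-((p : ℚ_[p]) / v))) := by
  have hmass := axisMeasure_univ_of_norm_eq_inv hv.norm_p_div
  set W := axisMeasure (-((p : ℚ_[p]) / v))
  have hW : W Set.univ ≠ 0 := by rw [hmass]; exact two_ne_zero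
  have : IsFiniteMeasure W := ⟨by rw [hmass]; exact ENNReal.ofNat_lt_top⟩
  have := isProbabilityMeasure_inv_smul hW
  have key := integral_eq_of_fibers hW
    (measurePreserving_mul_prod_right μ ((W Set.univ)⁻¹ • W)
      (continuous_rotX_coe hv).measurable) hφ (g := fun c : ℚ_[p] => φ (rotX hv c)) ?_
  · rwa [hmass, ENNReal.toReal_ofNat, Complex.ofReal_ofNat, ← one_div] at key
  · intro R
    obtain ⟨α, b, γ, -, -, rfl⟩ := exists_decomposition hp hv R
    obtain ⟨T, hT, hTe⟩ := actsBy_rotX hv γ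
    obtain ⟨γ', hγ'⟩ := exists_rotX_inv hv γ
    obtain ⟨U, hU, hUe⟩ := actsBy_rotX hv γ'
    refine ⟨T, U, hT, hU, hTe.mono fun s hs => ?_, hUe.mono fun s hs => ?_⟩
    · simp only
      rw [mul_assoc, hs, h]
    · have hs' : rotX hv s = rotX hv γ * rotX hv (U s : ℚ_[p]) := by
        rw [← inv_mul_eq_iff_eq_mul, hγ']
        exact hs
      simp only
      rw [mul_assoc, ← hs', h]

/-! ### Rotations about `y`: isometric reparametrisation of `ℤ_p` -/

theorem norm_mat_zero_zero_le (hp : 2 < p) (hv : IsVParam v) (R : SO3 v) :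
    max ‖SO3.mat R 0 0‖ ‖SO3.mat R 1 0‖ = 1 ∧ ‖SO3.mat R 2 0‖ ≤ 1 :=
  max_norm_eq_one_of_form_eq_one hp hv.nonquadratic (SO3.column_zero R)

theorem measurePreserving_of_isometry {θ : ℚ_[p] → ℚ_[p]} (hθ : Isometry θ)
    (hm : Set.MapsTo θ (closedBall 0 1) (closedBall 0 1)) :
    MeasurePreserving θ ((padicHaar p).restrict (closedBall 0 1))
      ((padicHaar p).restrict (closedBall 0 1)) := by
  have hn : ∀ x y, ‖θ x - θ y‖ = ‖x - y‖ := fun x y => by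
    rw [← dist_eq_norm, hθ.dist_eq, dist_eq_norm]
  have hs : θ '' closedBall 0 1 = closedBall 0 1 :=
    hm.image_subset.antisymm (surjOn_closedBall_of_norm_sub_eq hm fun x _ y _ => hn x y)
  refine ⟨hθ.continuous.measurable, ?_⟩
  ext A hA
  rw [Measure.map_apply hθ.continuous.measurable hA,
    Measure.restrict_apply (hθ.continuous.measurable hA), Measure.restrict_apply hA,
    ← one_mul (padicHaar p (θ ⁻¹' A ∩ closedBall 0 1)), ← ENNReal.coe_one,
    ← padicHaar_image one_ne_zero fun x _ y _ => by rw [hn, NNReal.coe_one, one_mul],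
    Set.image_preimage_inter, hs]

/-- By the ultrametric inequality, distances between `ℤ_p` and its complement see only the outer
point. A global isometry is a measurable embedding, so integrals can be transported without knowing
that `φ` is measurable along the `y` rotations. -/
theorem isometry_ite_closedBall {f : ℚ_[p] → ℚ_[p]}
    (hm : Set.MapsTo f (closedBall 0 1) (closedBall 0 1))
    (h : ∀ x ∈ closedBall (0 : ℚ_[p]) 1, ∀ y ∈ closedBall (0 : ℚ_[p]) 1, ‖f x - f y‖ = ‖x - y‖) :
    Isometry fun x => open Classical in if x ∈ closedBall (0 : ℚ_[p]) 1 then f x else x := by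
  have hmix : ∀ x y : ℚ_[p], x ∈ closedBall (0 : ℚ_[p]) 1 → y ∉ closedBall (0 : ℚ_[p]) 1 →
      ‖x - y‖ = ‖y‖ := by
    intro x y hx hy
    rw [mem_closedBall, dist_zero_right] at hx hy
    rw [norm_sub_rev, sub_eq_add_neg, norm_add_eq_left]
    rw [norm_neg]
    linarith
  refine Isometry.of_dist_eq fun x y => ?_
  simp only [dist_eq_norm]
  split_ifs with hx hy hy
  · exact h x hx y hy
  · rw [hmix _ _ (hm hx) hy, hmix _ _ hx hy]
  · rw [norm_sub_rev, hmix _ _ (hm hy) hx, norm_sub_rev, hmix _ _ hy hx]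
  · rfl

theorem norm_sinY_cosY_comb_sub (hp : 2 < p) {x z : ℚ_[p]} (hx : ‖x‖ = 1) (hz : ‖z‖ ≤ 1)
    {b c : ℚ_[p]} (hb : ‖b‖ ≤ 1) (hc : ‖c‖ ≤ 1) :
    ‖(sinY b * x + cosY b * z) - (sinY c * x + cosY c * z)‖ = ‖b - c‖ := by
  rcases eq_or_ne b c with rfl | hbc
  · simp
  rw [show (sinY b * x + cosY b * z) - (sinY c * x + cosY c * z) =
    (sinY b - sinY c) * x + (cosY b - cosY c) * z by ring]
  have h1 : ‖(sinY b - sinY c) * x‖ = ‖b - c‖ := by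
    rw [norm_mul, hx, mul_one, norm_sinY_sub hp hb hc]
  rw [norm_add_eq_left, h1]
  rw [h1, norm_mul]
  exact (mul_le_of_le_one_right (norm_nonneg _) hz).trans_lt (norm_cosY_sub_lt hb hc hbc)

theorem mat_rotY_mul_two_zero (b : ℚ_[p]) (Q : SO3 v) :
    SO3.mat (rotY v b * Q) 2 0 = sinY b * SO3.mat Q 0 0 + cosY b * SO3.mat Q 2 0 := by
  simp [matY_coe', Matrix.mul_apply, Fin.sum_univ_three]

/-- The new parameter `f b` satisfies `sinY (f b) = sinY b * Q 0 0 + cosY b * Q 2 0`. The right side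
is isometric in `b` since `Q 0 0` is a unit, and `sinY` is isometric. -/
theorem exists_isometry_rotY_mul (hp : 2 < p) (hv : IsVParam v) {φ : SO3 v → ℂ}
    (h : ∀ α β γ : OnePoint ℚ_[p], φ (rotZ hv α * rotY v β * rotX hv γ) = φ (rotY v β))
    {Q : SO3 v} (hQ : ‖SO3.mat Q 0 0‖ = 1) :
    ∃ θ : ℚ_[p] → ℚ_[p], Isometry θ ∧ Set.MapsTo θ (closedBall 0 1) (closedBall 0 1) ∧
      ∀ b ∈ closedBall (0 : ℚ_[p]) 1, φ (rotY v b * Q) = φ (rotY v (θ b : ℚ_[p])) := by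
  classical
  have hz := (norm_mat_zero_zero_le hp hv Q).2
  choose α f γ hf1 hf2 hf3 using fun b : ℚ_[p] => exists_decomposition hp hv (rotY v b * Q)
  have hm : Set.MapsTo f (closedBall 0 1) (closedBall 0 1) := fun b _ => by simpa using hf1 b
  refine ⟨fun x => if x ∈ closedBall (0 : ℚ_[p]) 1 then f x else x,
    isometry_ite_closedBall hm fun x hx y hy => ?_, ?_, ?_⟩
  · rw [mem_closedBall, dist_zero_right] at hx hy
    rw [← norm_sinY_sub hp (hf1 x) (hf1 y), hf2, hf2, mat_rotY_mul_two_zero,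
      mat_rotY_mul_two_zero, norm_sinY_cosY_comb_sub hp hQ hz hx hy]
  · intro b hb
    simp only [if_pos hb]
    exact hm hb
  · intro b hb
    simp only [if_pos hb]
    conv_lhs => rw [hf3 b]
    exact h _ _ _

theorem apply_rotZ_mul (hp : 2 < p) (hv : IsVParam v) {φ : SO3 v → ℂ}
    (h : ∀ α β γ : OnePoint ℚ_[p], φ (rotZ hv α * rotY v β * rotX hv γ) = φ (rotY v β))
    (α : OnePoint ℚ_[p]) (R : SO3 v) : φ (rotZ hv α * R) = φ R := by
  obtain ⟨α', b, γ, -, -, rfl⟩ := exists_decomposition hp hv R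
  obtain ⟨δ, hδ⟩ := exists_rotZ_mul hv α α'
  rw [← mul_assoc, ← mul_assoc, hδ, h, h]

theorem isProbabilityMeasure_restrict_closedBall :
    IsProbabilityMeasure ((padicHaar p).restrict (closedBall 0 1)) :=
  ⟨by rw [Measure.restrict_apply_univ, padicHaar_closedBall_zero_one]⟩

/-- Average over left translates by the conjugates of `R_y(b)` under `R_z(α)`. As `φ` ignores
rotations about `z` on the left, this evaluates `φ` at `R_y(b) Q` with `Q = R_z(α) R`, whose top
left entry is a unit; `S` must be stable under these translates. -/
theorem setIntegral_eq_of_invariant_rotY (hp : 2 < p) (hv : IsVParam v) (μ : Measure (SO3 v))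
    [μ.IsHaarMeasure] [IsProbabilityMeasure μ] {φ : SO3 v → ℂ} (hφ : Integrable φ μ)
    (h : ∀ α β γ : OnePoint ℚ_[p], φ (rotZ hv α * rotY v β * rotX hv γ) = φ (rotY v β))
    {S : Set (SO3 v)} (hS : MeasurableSet S) (α : OnePoint ℚ_[p])
    (hinv : ∀ b : ℚ_[p], ‖b‖ ≤ 1 → ∀ R, (rotZ hv α)⁻¹ * rotY v b * rotZ hv α * R ∈ S ↔ R ∈ S)
    (hunit : ∀ R ∈ S, ‖SO3.mat (rotZ hv α * R) 0 0‖ = 1) :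
    (μ S ≠ 0 → IntegrableOn (fun b : ℚ_[p] => φ (rotY v b)) (closedBall 0 1) (padicHaar p)) ∧
      ∫ R in S, φ R ∂μ =
        μ.real S * ∫ b in closedBall 0 1, φ (rotY v (b : ℚ_[p])) ∂(padicHaar p) := by
  have := isProbabilityMeasure_restrict_closedBall (p := p)
  have hB : MeasurableSet (closedBall (0 : ℚ_[p]) 1) := isClosed_closedBall.measurableSet
  obtain ⟨α', hα'⟩ := exists_rotZ_inv hv α
  have hfib : ∀ R ∈ S, ∃ θ : ℚ_[p] → ℚ_[p], Isometry θ ∧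
      Set.MapsTo θ (closedBall 0 1) (closedBall 0 1) ∧ ∀ b ∈ closedBall (0 : ℚ_[p]) 1,
        S.indicator φ ((rotZ hv α)⁻¹ * rotY v b * rotZ hv α * R) = φ (rotY v (θ b : ℚ_[p])) := by
    intro R hR
    obtain ⟨θ, h1, h2, h3⟩ := exists_isometry_rotY_mul hp hv h (hunit R hR)
    refine ⟨θ, h1, h2, fun b hb => ?_⟩
    rw [Set.indicator_of_mem ((hinv b (by simpa using hb) R).2 hR), ← h3 b hb, hα', mul_assoc,
      mul_assoc, apply_rotZ_mul hp hv h]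
  have hmeas : Measurable fun b : ℚ_[p] => (rotZ hv α)⁻¹ * rotY v b * rotZ hv α :=
    ((continuous_const.mul continuous_rotY_coe).mul continuous_const).measurable
  obtain ⟨hi, he⟩ := integral_eq_integral_integral_of_measurePreserving
    (measurePreserving_mul_prod μ ((padicHaar p).restrict (closedBall 0 1)) hmeas)
    (hφ.indicator hS)
  constructor
  · intro hS0
    obtain ⟨R, hR, hRi⟩ : ∃ R ∈ S, Integrable (fun b : ℚ_[p] =>
        S.indicator φ ((rotZ hv α)⁻¹ * rotY v b * rotZ hv α * R))
          ((padicHaar p).restrict (closedBall 0 1)) := by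
      by_contra! hcon
      exact hS0 (measure_mono_null (fun R hR => hcon R hR) (ae_iff.1 hi))
    obtain ⟨θ, h1, h2, h3⟩ := hfib R hR
    have h4 : Integrable ((fun b : ℚ_[p] => φ (rotY v b)) ∘ θ)
        ((padicHaar p).restrict (closedBall 0 1)) :=
      hRi.congr ((ae_restrict_mem hB).mono fun b hb => h3 b hb)
    exact ((measurePreserving_of_isometry h1 h2).integrable_comp_emb
      h1.isClosedEmbedding.measurableEmbedding).1 h4
  · rw [← integral_indicator hS, he]
    have hinner : ∀ R, ∫ b in closedBall 0 1,
        S.indicator φ ((rotZ hv α)⁻¹ * rotY v (b : ℚ_[p]) * rotZ hv α * R) ∂(padicHaar p) =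
          S.indicator
            (fun _ => ∫ b in closedBall 0 1, φ (rotY v (b : ℚ_[p])) ∂(padicHaar p)) R := by
      intro R
      by_cases hR : R ∈ S
      · rw [Set.indicator_of_mem hR]
        obtain ⟨θ, h1, h2, h3⟩ := hfib R hR
        rw [setIntegral_congr_fun hB h3]
        exact (measurePreserving_of_isometry h1 h2).integral_comp
          h1.isClosedEmbedding.measurableEmbedding (fun b : ℚ_[p] => φ (rotY v b))
      · rw [Set.indicator_of_notMem hR]
        refine (setIntegral_congr_fun hB fun b hb => ?_).trans (integral_zero _ _)
        exact Set.indicator_of_notMem (fun hcon => hR ((hinv b (by simpa using hb) R).1 hcon)) _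
    simp only [hinner]
    rw [integral_indicator_const _ hS, Complex.real_smul]

/-- Modulo `p` the first row of `R_y(b)` is that of the identity, so the top left entry changes only
by a multiple of `p`. -/
theorem norm_conj_rotY_mul_sub_lt (hp : 2 < p) (hv : IsVParam v) (α : OnePoint ℚ_[p])
    {b : ℚ_[p]} (hb : ‖b‖ ≤ 1) (R : SO3 v) :
    ‖SO3.mat ((rotZ hv α)⁻¹ * rotY v b * rotZ hv α * R) 0 0 - SO3.mat R 0 0‖ < 1 := by
  obtain ⟨α', hα'⟩ := exists_rotZ_inv hv α
  obtain ⟨A, B, -, hm⟩ := exists_matZ_eq hv α'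
  have hA : ‖A‖ ≤ 1 := by
    have h1 := (norm_mat_zero_zero_le hp hv (rotZ hv α')).1
    rw [mat_rotZ, hm] at h1
    exact (le_max_left _ _).trans h1.le
  set Q := rotZ hv α * R with hQ
  have e : SO3.mat ((rotZ hv α)⁻¹ * rotY v b * rotZ hv α * R) 0 0 - SO3.mat R 0 0 =
      A * ((cosY b - 1) * SO3.mat Q 0 0 - p * sinY b * SO3.mat Q 2 0) := by
    have hR : R = rotZ hv α' * Q := by rw [hQ, ← hα', inv_mul_cancel_left]
    have h1 : (rotZ hv α)⁻¹ * rotY v b * rotZ hv α * R = rotZ hv α' * (rotY v b * Q) := by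
      rw [hQ, ← hα']; group
    rw [h1]
    conv_lhs => rw [hR]
    simp only [SO3.mat_mul, mat_rotZ, mat_rotY, hm, matY_coe']
    simp [Matrix.vecMul, dotProduct, Fin.sum_univ_three]
    ring
  have hcos : cosY b - 1 = p * (-b * sinY b) := by
    have := denomY_ne_zero b
    simp only [cosY, sinY]
    field_simp
    ring
  have hs : ‖sinY b‖ ≤ 1 := by rwa [norm_sinY hp hb]
  obtain ⟨hQ1, hQ2⟩ := norm_mat_zero_zero_le hp hv Q
  have hQ0 : ‖SO3.mat Q 0 0‖ ≤ 1 := (le_max_left _ _).trans hQ1.le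
  rw [e, hcos, show A * (p * (-b * sinY b) * SO3.mat Q 0 0 - p * sinY b * SO3.mat Q 2 0) =
    p * (A * (sinY b * (-b * SO3.mat Q 0 0 + -SO3.mat Q 2 0))) by ring, norm_mul, Padic.norm_p]
  refine mul_lt_one_of_nonneg_of_lt_one_left (inv_nonneg.2 cast_prime_pos.le)
    (inv_lt_one_of_one_lt₀ one_lt_cast_prime) ?_
  rw [norm_mul, norm_mul]
  refine mul_le_one₀ hA (by positivity) (mul_le_one₀ hs (norm_nonneg _) ?_)
  refine (Padic.nonarchimedean _ _).trans (max_le ?_ (by rwa [norm_neg]))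
  rw [norm_mul, norm_neg]
  exact mul_le_one₀ hb (norm_nonneg _) hQ0

theorem norm_eq_one_iff_of_sub_lt {x y : ℚ_[p]} (h : ‖x - y‖ < 1) : ‖x‖ = 1 ↔ ‖y‖ = 1 := by
  constructor
  · intro hx
    rw [← hx, ← sub_add_cancel y x, add_comm, norm_add_eq_left]
    rwa [hx, norm_sub_rev]
  · intro hy
    rw [← hy, ← sub_add_cancel x y, add_comm, norm_add_eq_left]
    rwa [hy]

theorem integral_eq_closedBall_of_invariant_rotY (hp : 2 < p) (hv : IsVParam v)
    (μ : Measure (SO3 v)) [μ.IsHaarMeasure] [IsProbabilityMeasure μ] {φ : SO3 v → ℂ}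
    (hφ : Integrable φ μ)
    (h : ∀ α β γ : OnePoint ℚ_[p], φ (rotZ hv α * rotY v β * rotX hv γ) = φ (rotY v β)) :
    IntegrableOn (fun b : ℚ_[p] => φ (rotY v b)) (closedBall 0 1) (padicHaar p) ∧
      ∫ R, φ R ∂μ = ∫ b in closedBall 0 1, φ (rotY v (b : ℚ_[p])) ∂(padicHaar p) := by
  set E : Set (SO3 v) := {R | ‖SO3.mat R 0 0‖ = 1} with hE
  have hEm : MeasurableSet E := by
    have hc : Continuous fun R : SO3 v => ‖SO3.mat R 0 0‖ :=
      (SO3.continuous_mat.matrix_elem 0 0).norm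
    exact (isClosed_eq hc continuous_const).measurableSet
  have hinv : ∀ (α : OnePoint ℚ_[p]) (b : ℚ_[p]), ‖b‖ ≤ 1 → ∀ R,
      (rotZ hv α)⁻¹ * rotY v b * rotZ hv α * R ∈ E ↔ R ∈ E := fun α b hb R =>
    norm_eq_one_iff_of_sub_lt (norm_conj_rotY_mul_sub_lt hp hv α hb R)
  obtain ⟨i1, e1⟩ := setIntegral_eq_of_invariant_rotY hp hv μ hφ h hEm
    ((0 : ℚ_[p]) : OnePoint ℚ_[p])
    (hinv _) (fun R hR => by
      rw [SO3.mat_mul, mat_rotZ, matZ_coe]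
      have hR' : ‖SO3.mat R 0 0‖ = 1 := hR
      simpa [Matrix.mul_apply, Fin.sum_univ_three] using hR')
  -- Off `E` the entry `R 1 0` must be a unit. `R_z(1)` brings it to the top with the unit
  -- coefficient `2v / (1 - v)`, and the term in `R 0 0` is too small to cancel it.
  obtain ⟨i2, e2⟩ := setIntegral_eq_of_invariant_rotY hp hv μ hφ h hEm.compl
    ((1 : ℚ_[p]) : OnePoint ℚ_[p]) (fun b hb R => not_congr (hinv _ b hb R)) (fun R hR => by
      have hd := (hv.nonquadratic.isAxisParam_neg hp).norm_of_le
      obtain ⟨h1, -⟩ := norm_mat_zero_zero_le hp hv R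
      have hlt : ‖SO3.mat R 0 0‖ < 1 := lt_of_le_of_ne ((le_max_left _ _).trans h1.le) hR
      have hy : ‖SO3.mat R 1 0‖ = 1 := by
        rcases max_choice ‖SO3.mat R 0 0‖ ‖SO3.mat R 1 0‖ with hm | hm
        · rw [hm] at h1; exact absurd h1 hlt.ne
        · rwa [hm] at h1
      have hv1 : ‖1 - v‖ = 1 := by simpa [← sub_eq_add_neg] using hd 1 (by simp)
      have e : SO3.mat (rotZ hv ((1 : ℚ_[p]) : OnePoint ℚ_[p]) * R) 0 0 =
          2 * v / (1 - v) * SO3.mat R 1 0 + (1 + v) / (1 - v) * SO3.mat R 0 0 := by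
        rw [SO3.mat_mul, mat_rotZ, matZ_coe]
        simp [Matrix.mul_apply, Fin.sum_univ_three]
        ring
      have hB : ‖2 * v / (1 - v) * SO3.mat R 1 0‖ = 1 := by
        rw [norm_mul, norm_div, norm_mul, norm_two hp, hv.nonquadratic.1, hv1, hy]
        norm_num
      rw [e, norm_add_eq_left, hB]
      rw [hB, norm_mul, norm_div, hv1, div_one]
      refine mul_lt_one_of_nonneg_of_lt_one_right ?_ (norm_nonneg _) hlt
      exact (Padic.nonarchimedean _ _).trans (by simp [hv.nonquadratic.1]))
  have hsum : μ.real E + μ.real Eᶜ = 1 := by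
    rw [measureReal_add_measureReal_compl hEm]; simp
  constructor
  -- At least one of `E` and its complement has positive measure, and either one yields
  -- integrability.
  · by_cases h0 : μ E = 0
    · refine i2 fun h0' => ?_
      simp [Measure.real, h0, h0'] at hsum
    · exact i1 h0
  · rw [← integral_add_compl hEm hφ, e1, e2, ← add_mul, ← Complex.ofReal_add, hsum,
      Complex.ofReal_one, one_mul]

/-- Inverting the parameter keeps the sine and negates the cosine. The half turns on either side are
invisible to `φ` in case 2, so the integral over the complement of `ℤ_p` repeats the one over `ℤ_p`.
-/
theorem rotY_inversion (hv : IsVParam v) {b : ℚ_[p]} (hb : b ≠ 0) :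
    rotY v ((1 / (p * b) : ℚ_[p]) : OnePoint ℚ_[p]) =
      rotZ hv OnePoint.infty * rotY v b * rotX hv OnePoint.infty := by
  have hp0 := p_ne_zero (p := p)
  have h1 := denomY_ne_zero b
  have e : 1 + p * (1 / (p * b)) ^ 2 = (1 + p * b ^ 2) / (p * b ^ 2) := by
    field_simp
    ring
  have hc : cosY (1 / ((p : ℚ_[p]) * b)) = -cosY b := by
    rw [cosY, e, show 1 - p * (1 / (p * b)) ^ 2 = -(1 - p * b ^ 2) / (p * b ^ 2) by
      field_simp; ring, div_div_div_cancel_right₀ (by positivity), neg_div, cosY]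
  have hs : sinY (1 / ((p : ℚ_[p]) * b)) = sinY b := by
    rw [sinY, e, sinY, div_div_eq_mul_div]
    congr 1
    field_simp
  apply SO3.mat_injective
  rw [SO3.mat_mul, SO3.mat_mul, mat_rotZ, mat_rotX, mat_rotY, mat_rotY, matY_coe', matY_coe', hc,
    hs, matZ_infty, matX_infty]
  ext i j
  fin_cases i <;> fin_cases j <;> simp [Matrix.mul_apply, Fin.sum_univ_three]

theorem integral_eq_of_invariant_rotY (hp : 2 < p) (hv : IsVParam v)
    (μ : Measure (SO3 v)) [μ.IsHaarMeasure] [IsProbabilityMeasure μ] {φ : SO3 v → ℂ}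
    (hφ : Integrable φ μ)
    (h : ∀ α β γ : OnePoint ℚ_[p], φ (rotZ hv α * rotY v β * rotX hv γ) = φ (rotY v β)) :
    Integrable (fun b : ℚ_[p] => φ (rotY v b)) (axisMeasure (p : ℚ_[p])) ∧
      ∫ R, φ R ∂μ = 1 / 2 * ∫ b : ℚ_[p], φ (rotY v b) ∂(axisMeasure (p : ℚ_[p])) := by
  have hpn : ‖(p : ℚ_[p])‖ = (p : ℝ)⁻¹ := Padic.norm_p
  have hd := isAxisParam_of_norm_eq_inv hpn
  have hB : MeasurableSet (closedBall (0 : ℚ_[p]) 1) := isClosed_closedBall.measurableSet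
  obtain ⟨hi, he⟩ := integral_eq_closedBall_of_invariant_rotY hp hv μ hφ h
  have hm : Measurable fun x : ℚ_[p] => 1 / ((p : ℚ_[p]) * x) :=
    measurable_const.div (measurable_const_mul (p : ℚ_[p]))
  have hinv := map_inversion_axisMeasure hd
  rw [setOf_norm_mul_lt_one hpn] at hinv
  have hflip : ∀ x ∈ (closedBall (0 : ℚ_[p]) 1)ᶜ,
      φ (rotY v ((1 / (p * x) : ℚ_[p]) : OnePoint ℚ_[p])) = φ (rotY v x) := by
    intro x hx
    have hx0 : x ≠ 0 := by
      rintro rfl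
      simp at hx
    rw [rotY_inversion hv hx0, h]
  have hMP : MeasurePreserving (fun x : ℚ_[p] => 1 / ((p : ℚ_[p]) * x))
      ((axisMeasure (p : ℚ_[p])).restrict (closedBall 0 1)ᶜ)
      ((padicHaar p).restrict (closedBall 0 1)) := ⟨hm, hinv⟩
  have hae : (fun x : ℚ_[p] => φ (rotY v ((1 / (p * x) : ℚ_[p]) : OnePoint ℚ_[p])))
      =ᵐ[(axisMeasure (p : ℚ_[p])).restrict (closedBall 0 1)ᶜ] fun x => φ (rotY v x) :=
    (ae_restrict_mem hB.compl).mono hflip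
  have hi1 : IntegrableOn (fun b : ℚ_[p] => φ (rotY v b)) (closedBall 0 1)
      (axisMeasure (p : ℚ_[p])) := by
    rw [IntegrableOn, axisMeasure_restrict_closedBall hd]
    exact hi
  have hi2 : IntegrableOn (fun b : ℚ_[p] => φ (rotY v b)) (closedBall 0 1)ᶜ
      (axisMeasure (p : ℚ_[p])) :=
    (hMP.integrable_comp_of_integrable (g := fun b : ℚ_[p] => φ (rotY v b)) hi).congr hae
  have hint : Integrable (fun b : ℚ_[p] => φ (rotY v b)) (axisMeasure (p : ℚ_[p])) := by
    rw [← integrableOn_univ, ← Set.union_compl_self (closedBall (0 : ℚ_[p]) 1)]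
    exact hi1.union hi2
  refine ⟨hint, ?_⟩
  have e2 : ∫ x in (closedBall (0 : ℚ_[p]) 1)ᶜ, φ (rotY v x) ∂(axisMeasure (p : ℚ_[p])) =
      ∫ b in closedBall 0 1, φ (rotY v (b : ℚ_[p])) ∂(padicHaar p) := by
    rw [← integral_congr_ae hae, ← hinv, integral_map hm.aemeasurable]
    rw [hinv]
    exact hi.aestronglyMeasurable
  rw [← integral_add_compl hB hint, e2, axisMeasure_restrict_closedBall hd, he]
  ring

end PadicRot

end

/-! ### The three integral formulas -/

theorem corollary5p2 (p : ℕ) [Fact p.Prime] (hp : 2 < p)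
    (v : ℚ_[p]) (hv : PadicRot.IsVParam v)
    (μ : Measure (PadicRot.SO3 v)) [μ.IsHaarMeasure] [IsProbabilityMeasure μ]
    (φ : PadicRot.SO3 v → ℂ) (hφ : Integrable φ μ) :
    ((∀ α β γ : OnePoint ℚ_[p],
        φ (PadicRot.rotZ hv α * PadicRot.rotY v β * PadicRot.rotX hv γ) =
          φ (PadicRot.rotZ hv α)) →
      Integrable (fun α : OnePoint ℚ_[p] =>
          φ (PadicRot.Tp hv (PadicRot.quatZ hv α)) * (PadicRot.weight (-v) α : ℂ))
          (PadicRot.lineHaar p) ∧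
      ∫ R, φ R ∂μ = (1 + 1 / (p : ℂ))⁻¹ *
        ∫ α : OnePoint ℚ_[p],
          φ (PadicRot.Tp hv (PadicRot.quatZ hv α)) * (PadicRot.weight (-v) α : ℂ)
          ∂(PadicRot.lineHaar p)) ∧
    ((∀ α β γ : OnePoint ℚ_[p],
        φ (PadicRot.rotZ hv α * PadicRot.rotY v β * PadicRot.rotX hv γ) =
          φ (PadicRot.rotY v β)) →
      Integrable (fun β : OnePoint ℚ_[p] =>
          φ (PadicRot.Tp hv (PadicRot.quatY v β)) * (PadicRot.weight (p : ℚ_[p]) β : ℂ))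
          (PadicRot.lineHaar p) ∧
      ∫ R, φ R ∂μ = 1 / 2 *
        ∫ β : OnePoint ℚ_[p],
          φ (PadicRot.Tp hv (PadicRot.quatY v β)) * (PadicRot.weight (p : ℚ_[p]) β : ℂ)
          ∂(PadicRot.lineHaar p)) ∧
    ((∀ α β γ : OnePoint ℚ_[p],
        φ (PadicRot.rotZ hv α * PadicRot.rotY v β * PadicRot.rotX hv γ) =
          φ (PadicRot.rotX hv γ)) →
      Integrable (fun γ : OnePoint ℚ_[p] =>
          φ (PadicRot.Tp hv (PadicRot.quatX hv γ)) * (PadicRot.weight (-((p : ℚ_[p]) / v)) γ : ℂ))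
          (PadicRot.lineHaar p) ∧
      ∫ R, φ R ∂μ = 1 / 2 *
        ∫ γ : OnePoint ℚ_[p],
          φ (PadicRot.Tp hv (PadicRot.quatX hv γ)) * (PadicRot.weight (-((p : ℚ_[p]) / v)) γ : ℂ)
          ∂(PadicRot.lineHaar p)) := by
  have eZ : ∀ α, φ (PadicRot.Tp hv (PadicRot.quatZ hv α)) = φ (PadicRot.rotZ hv α) := fun α => by
    rw [PadicRot.Tp_quatZ]
  have eY : ∀ β, φ (PadicRot.Tp hv (PadicRot.quatY v β)) = φ (PadicRot.rotY v β) := fun β => by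
    rw [PadicRot.Tp_quatY]
  have eX : ∀ γ, φ (PadicRot.Tp hv (PadicRot.quatX hv γ)) = φ (PadicRot.rotX hv γ) := fun γ => by
    rw [PadicRot.Tp_quatX]
  simp only [eZ, eY, eX]
  refine ⟨fun h => ?_, fun h => ?_, fun h => ?_⟩
  · rw [PadicRot.integrable_mul_weight_lineHaar_iff (-v) fun α => φ (PadicRot.rotZ hv α),
      PadicRot.integral_mul_weight_lineHaar (-v) fun α => φ (PadicRot.rotZ hv α)]
    exact PadicRot.integral_eq_of_invariant_rotZ hp hv μ hφ h
  · rw [PadicRot.integrable_mul_weight_lineHaar_iff p fun β => φ (PadicRot.rotY v β),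
      PadicRot.integral_mul_weight_lineHaar p fun β => φ (PadicRot.rotY v β)]
    exact PadicRot.integral_eq_of_invariant_rotY hp hv μ hφ h
  · rw [PadicRot.integrable_mul_weight_lineHaar_iff _ fun γ => φ (PadicRot.rotX hv γ),
      PadicRot.integral_mul_weight_lineHaar _ fun γ => φ (PadicRot.rotX hv γ)]
    exact PadicRot.integral_eq_of_invariant_rotX hp hv μ hφ h
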